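/- Fix constants $C_1>0$ and $1<b<2$. For momenta $\mathbf p,\mathbf q\in\mathbb R^3$ write $p=|\mathbf p|$, $q=|\mathbf q|$, $\varrho=\sqrt{2(pq-\mathbf p\cdot\mathbf q)}$, and for $\omega\in\mathbb S^2$ let \[ \mathbf p'=\tfrac12(\mathbf p+\mathbf q)+\tfrac12\varrho\,\omega+\tfrac12\big((\mathbf p+\mathbf q)\cdot\omega\big)\frac{\mathbf p+\mathbf q}{p+q+\varrho}, \] and let $\mathbf q'$ be the same expression with $\omega$ replaced by $-\omega$. For $\varepsilon>0$ define the modified collision operator \[ Q_\varepsilon(f,f)(\mathbf p)=C_1\iint_{\varrho\ge\varepsilon}\frac{\varrho^{2-b}}{pq}\Big(f(\mathbf p')f(\mathbf q')-f(\mathbf p)f(\mathbf q)\Big)\,d\omega\,d^3q , \] the integral being over $(\mathbf q,\omega)\in\mathbb R^3\times\mathbb S^2$ with $\varrho\ge\varepsilon$. Let $f_0\in L^1(\mathbb R^3)$ with $f_0\ge0$. (i) For every $\varepsilon>0$ the modified equation $\partial_s f=Q_\varepsilon(f,f)$, $f(0)=f_0$, has a unique solution $f\in C^1([0,\infty);L^1(\mathbb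 R^3))$ (unique among all such solutions, of whatever sign; the integral defining $Q_\varepsilon(f(s),f(s))(\mathbf p)$ converges absolutely for all $s\ge0$ and almost every $\mathbf p$), and $f(s)\ge0$ for all $s\ge 0$. If $f_0$ is isotropic, i.e. depends on $|\mathbf p|$ only, then so is $f(s)$ for every $s\ge 0$. (ii) Suppose moreover that $f_0$ is isotropic and that $\int_{\mathbb R^3}f_0(\mathbf p)\,p^m\,d^3p<\infty$ for all real $m$ with $-2\le m\le2$. Then there are $T>0$ and a constant $C_T$, both independent of $\varepsilon$, such that for every $\varepsilon>0$ the solution $f$ of (i) satisfies \[ \sup_{0\le s\le T}\int_{\mathbb R^3}f(s,\mathbf p)\,p^m\,d^3p\le C_T\qquad\text{for all real } m \text{ with } -2\le m\le 2 . \] -/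

import Mathlib

open MeasureTheory Set

namespace MasslessBoltzmann

noncomputable section

/-- Momentum space `ℝ³` with the Euclidean norm; the energy of a massless particle with momentum
`p` is `‖p‖`. -/
abbrev Mom : Type := EuclideanSpace ℝ (Fin 3)

/-- The unit sphere of `ℝ³`. -/
abbrev S2 : Type := Metric.sphere (0 : Mom) 1

/-- The standard surface measure `dω` on the unit sphere (total mass `4π`). -/
abbrev sphereMeasure : Measure S2 := (volume : Measure Mom).toSphere

/-- The Banach space `L¹(ℝ³)`. -/
abbrev L1 : Type := Lp ℝ 1 (volume : Measure Mom)

/-- The relative momentum `ϱ = √(2 (|p||q| - p·q))`. -/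
def rho (p q : Mom) : ℝ := Real.sqrt (2 * (‖p‖ * ‖q‖ - inner ℝ p q))

/-- The outgoing momentum `p'` for the scattering direction `w`:
`p' = (p+q)/2 + ϱ w / 2 + ((p+q)·w) (p+q) / (2 (|p|+|q|+ϱ))`. -/
def outP (p q w : Mom) : Mom :=
  (1 / 2 : ℝ) • (p + q) + (rho p q / 2) • w
    + (inner ℝ (p + q) w / (2 * (‖p‖ + ‖q‖ + rho p q))) • (p + q)

/-- The outgoing momentum `q'`: the same expression with the sign of `w` switched. -/
def outQ (p q w : Mom) : Mom := outP p q (-w)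

/-- The collision kernel `ϱ^(2-b) / (|p||q|)`, restricted to `ϱ ≥ ε`. -/
def cutKernel (b ε : ℝ) (p q : Mom) : ℝ :=
  if ε ≤ rho p q then rho p q ^ (2 - b) / (‖p‖ * ‖q‖) else 0

/-- The integrand of the modified collision operator at `p`, as a function of `(q, ω)`. -/
def collisionIntegrand (b ε : ℝ) (f : Mom → ℝ) (p : Mom) (x : Mom × S2) : ℝ :=
  cutKernel b ε p x.1 *
    (f (outP p x.1 (x.2 : Mom)) * f (outQ p x.1 (x.2 : Mom)) - f p * f x.1)

/-- The modified collision operator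
`Q_ε(f,f)(p) = C₁ ∬_{ϱ ≥ ε} ϱ^(2-b)/(|p||q|) (f(p') f(q') - f(p) f(q)) dω d³q`. -/
def collisionOp (C₁ b ε : ℝ) (f : Mom → ℝ) (p : Mom) : ℝ :=
  C₁ * ∫ x, collisionIntegrand b ε f p x ∂((volume : Measure Mom).prod sphereMeasure)

/-- `f ∈ C¹([0,∞); L¹)` (only the values `f s` with `0 ≤ s` matter) solves
`∂_s f = Q_ε(f,f)`, `f(0) = f₀`. The collision integral is required to converge absolutely at
almost every momentum. -/
structure IsModifiedSolution (C₁ b ε : ℝ) (f₀ : L1) (f : ℝ → L1) : Prop where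
  initial : f 0 = f₀
  integrable : ∀ s : ℝ, 0 ≤ s → ∀ᵐ p : Mom,
    Integrable (collisionIntegrand b ε (f s) p) ((volume : Measure Mom).prod sphereMeasure)
  equation : ∃ f' : ℝ → L1, ContinuousOn f' (Ici 0) ∧
    ∀ s : ℝ, 0 ≤ s → HasDerivWithinAt f (f' s) (Ici 0) s ∧
      (f' s : Mom → ℝ) =ᵐ[volume] collisionOp C₁ b ε (f s)

/-- `f` is isotropic: almost everywhere it depends on `|p|` only. -/
def IsIsotropic (f : L1) : Prop :=
  ∃ g : ℝ → ℝ, Measurable g ∧ (f : Mom → ℝ) =ᵐ[volume] fun p => g ‖p‖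

/-- The integrand `f(p) |p|^m` of the moment of order `m`. -/
def momentIntegrand (m : ℝ) (f : L1) (p : Mom) : ℝ := f p * ‖p‖ ^ m

end

end MasslessBoltzmann

namespace MasslessBoltzmann

noncomputable section

/-! A pair of massless momenta is described by its total momentum `P`, its relative momentum `ϱ` and
a direction `w` on the sphere. A collision keeps `P` and `ϱ` and replaces `w` by a free direction.
In these coordinates the Jacobian cancels the factor `1/(|p||q|)` of the kernel up to a weight
depending on `P` and `ϱ` only (`boostJac_mul_cutKernel`), so incoming and outgoing directions enter
symmetrically (`lintegral_collision_symm`). Gain and loss therefore have equal mass.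

Existence: `ϱ² ≤ 4|p||q|` bounds the cut kernel by `4 ε^(-b)`, so gain and loss are bounded bilinear
operators on `L¹`. Adding a large multiple of `(∫ g) f` turns the collision operator into a bilinear
`Γ` that preserves the nonnegative cone and multiplies masses there (`shifted_nonneg`,
`norm_shifted`). The equation becomes `f' = Γ(f, f) - l f` with `l` proportional to the conserved
mass, and the Wild sum solves it globally with nonnegative coefficients. Isotropy is a closed linear
condition preserved by `Γ`, so it passes to the sum. Uniqueness is Grönwall for a locally Lipschitz
field and needs no sign.

Moments: the single weight `W = 1 + |p|² + |p|⁻²` controls all exponents in `[-2, 2]`. The angular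
mean of `|p'|⁻²` is `O(ϱ⁻²)`, which the `ϱ²` of the kernel absorbs. What remains is at most a
constant times `(1 - cos θ)^(-b/2) W(p) W(q)`. For isotropic `f` the angle averages out, with finite
mean because `b < 2`, so the gain of `∫ W f` is at most a constant, free of `ε`, times `(∫ W f)²`. A
Riccati comparison then gives a uniform time. To differentiate legitimately, `W` is truncated at a
level `R`; the estimate survives once `R` exceeds a level depending on `ε`
(`cutKernel_mul_lintegral_cutWeight_le`), while the constant does not, and `R → ∞` by monotone
convergence. -/

/-- The momentum obtained by boosting `ϱ w / 2` from the frame with vanishing total momentum to the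
frame with total momentum `P`. -/
def boost (P : Mom) (s : ℝ) (w : Mom) : Mom :=
  (1 / 2 : ℝ) • P + (s / 2) • w + (inner ℝ P w / (2 * (Real.sqrt (‖P‖ ^ 2 + s ^ 2) + s))) • P

/-! ### Collision kinematics. -/

theorem rho_nonneg (p q : Mom) : 0 ≤ rho p q := Real.sqrt_nonneg _

theorem rho_sq (p q : Mom) : rho p q ^ 2 = 2 * (‖p‖ * ‖q‖ - inner ℝ p q) :=
  Real.sq_sqrt (by linarith [real_inner_le_norm p q])

theorem norm_add_sq_add_rho_sq (p q : Mom) :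
    ‖p + q‖ ^ 2 + rho p q ^ 2 = (‖p‖ + ‖q‖) ^ 2 := by
  rw [rho_sq, norm_add_sq_real]; ring

theorem sqrt_norm_add_sq_add_rho_sq (p q : Mom) :
    Real.sqrt (‖p + q‖ ^ 2 + rho p q ^ 2) = ‖p‖ + ‖q‖ := by
  rw [norm_add_sq_add_rho_sq, Real.sqrt_sq (by positivity)]

theorem rho_eq_of_sq {p q : Mom} {s : ℝ} (hs : 0 ≤ s)
    (h : ‖p + q‖ ^ 2 + s ^ 2 = (‖p‖ + ‖q‖) ^ 2) : rho p q = s := by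
  have := norm_add_sq_add_rho_sq p q
  exact (sq_eq_sq₀ (rho_nonneg p q) hs).1 (by linarith)

theorem rho_comm (p q : Mom) : rho p q = rho q p := by
  simp only [rho, real_inner_comm q p, mul_comm ‖p‖]

theorem rho_sq_le (p q : Mom) : rho p q ^ 2 ≤ 4 * (‖p‖ * ‖q‖) := by
  have := (abs_le.1 (abs_real_inner_le_norm p q)).1
  rw [rho_sq]; linarith

theorem norm_mul_norm_pos_of_rho_pos {p q : Mom} (h : 0 < rho p q) : 0 < ‖p‖ * ‖q‖ := by
  have := rho_sq_le p q
  have : 0 < rho p q ^ 2 := by positivity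
  linarith

theorem outP_eq_boost (p q w : Mom) : outP p q w = boost (p + q) (rho p q) w := by
  rw [outP, boost, sqrt_norm_add_sq_add_rho_sq]

theorem boost_add_boost_neg (P : Mom) (s : ℝ) (w : Mom) : boost P s w + boost P s (-w) = P := by
  simp only [boost, inner_neg_right, neg_div, neg_smul, smul_neg]
  module

theorem abs_inner_le_sqrt (P : Mom) (s : ℝ) {w : Mom} (hw : ‖w‖ = 1) :
    |inner ℝ P w| ≤ Real.sqrt (‖P‖ ^ 2 + s ^ 2) := by
  refine (abs_real_inner_le_norm P w).trans ?_
  rw [hw, mul_one]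
  exact Real.le_sqrt_of_sq_le (by nlinarith [sq_nonneg s])

/-- A Lorentz boost of a massless momentum of energy `s / 2` has energy affine in the cosine of the
angle between `P` and `w`. After squaring this is an algebraic identity using `E² = ‖P‖² + s²`. -/
theorem norm_boost (P : Mom) {s : ℝ} (hs : 0 < s) {w : Mom} (hw : ‖w‖ = 1) :
    ‖boost P s w‖ = (Real.sqrt (‖P‖ ^ 2 + s ^ 2) + inner ℝ P w) / 2 := by
  have hx := abs_inner_le_sqrt P s hw
  have hE : Real.sqrt (‖P‖ ^ 2 + s ^ 2) ^ 2 = ‖P‖ ^ 2 + s ^ 2 := Real.sq_sqrt (by positivity)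
  have hE0 : 0 ≤ Real.sqrt (‖P‖ ^ 2 + s ^ 2) := Real.sqrt_nonneg _
  have h1 := (abs_le.1 hx).1
  set E := Real.sqrt (‖P‖ ^ 2 + s ^ 2) with hEdef
  rw [← sq_eq_sq₀ (norm_nonneg _) (by linarith)]
  have hb : boost P s w = ((1 / 2 : ℝ) + inner ℝ P w / (2 * (E + s))) • P + (s / 2) • w := by
    rw [boost]; module
  rw [hb, norm_add_sq_real, norm_smul, norm_smul, inner_smul_left, inner_smul_right, hw, mul_pow,
    mul_pow, Real.norm_eq_abs, Real.norm_eq_abs, sq_abs, sq_abs,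
    show ‖P‖ ^ 2 = E ^ 2 - s ^ 2 by linarith]
  have : E + s ≠ 0 := by positivity
  simp only [conj_trivial]
  field_simp
  ring

theorem norm_boost_add_norm_boost_neg (P : Mom) {s : ℝ} (hs : 0 < s) {w : Mom} (hw : ‖w‖ = 1) :
    ‖boost P s w‖ + ‖boost P s (-w)‖ = Real.sqrt (‖P‖ ^ 2 + s ^ 2) := by
  rw [norm_boost P hs hw, norm_boost P hs (by rwa [norm_neg]), inner_neg_right]
  ring

theorem rho_boost (P : Mom) {s : ℝ} (hs : 0 < s) {w : Mom} (hw : ‖w‖ = 1) :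
    rho (boost P s w) (boost P s (-w)) = s := by
  refine rho_eq_of_sq hs.le ?_
  rw [boost_add_boost_neg, norm_boost_add_norm_boost_neg P hs hw, Real.sq_sqrt (by positivity)]

/-- The outgoing pair depends on the incoming one only through the total momentum and `rho`, so the
incoming direction `w` is forgotten. -/
theorem outP_boost (P : Mom) {s : ℝ} (hs : 0 < s) {w : Mom} (hw : ‖w‖ = 1) (v : Mom) :
    outP (boost P s w) (boost P s (-w)) v = boost P s v := by
  rw [outP_eq_boost, boost_add_boost_neg, rho_boost P hs hw]

theorem outQ_boost (P : Mom) {s : ℝ} (hs : 0 < s) {w : Mom} (hw : ‖w‖ = 1) (v : Mom) :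
    outQ (boost P s w) (boost P s (-w)) v = boost P s (-v) :=
  outP_boost P hs hw (-v)

theorem norm_outP {p q : Mom} (h : 0 < rho p q) {w : Mom} (hw : ‖w‖ = 1) :
    ‖outP p q w‖ = (‖p‖ + ‖q‖ + inner ℝ (p + q) w) / 2 := by
  rw [outP_eq_boost, norm_boost _ h hw, sqrt_norm_add_sq_add_rho_sq]

theorem norm_outQ {p q : Mom} (h : 0 < rho p q) {w : Mom} (hw : ‖w‖ = 1) :
    ‖outQ p q w‖ = (‖p‖ + ‖q‖ - inner ℝ (p + q) w) / 2 := by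
  rw [outQ, norm_outP h (by rwa [norm_neg]), inner_neg_right, sub_eq_add_neg]

theorem norm_outP_le {p q : Mom} (h : 0 < rho p q) {w : Mom} (hw : ‖w‖ = 1) :
    ‖outP p q w‖ ≤ ‖p‖ + ‖q‖ := by
  have := norm_outQ h hw
  have h2 := norm_nonneg (outQ p q w)
  rw [norm_outP h hw]
  linarith

/-- The product of the energies of a pair with given total momentum. -/
theorem norm_boost_mul_norm_boost_neg (P : Mom) {s : ℝ} (hs : 0 < s) {w : Mom} (hw : ‖w‖ = 1) :
    ‖boost P s w‖ * ‖boost P s (-w)‖ = (‖P‖ ^ 2 + s ^ 2 - inner ℝ P w ^ 2) / 4 := by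
  have hE : Real.sqrt (‖P‖ ^ 2 + s ^ 2) ^ 2 = ‖P‖ ^ 2 + s ^ 2 := Real.sq_sqrt (by positivity)
  rw [norm_boost P hs hw, norm_boost P hs (by rwa [norm_neg]), inner_neg_right]
  linear_combination hE / 4

/-! ### The boost as a change of variables. -/

/-- The boost in terms of the momentum `k = ϱ w / 2` in the frame of vanishing total momentum. -/
def boostMap (P k : Mom) : Mom :=
  (1 / 2 : ℝ) • P + k +
    (inner ℝ P k * (2 * ‖k‖ * (Real.sqrt (‖P‖ ^ 2 + 4 * ‖k‖ ^ 2) + 2 * ‖k‖))⁻¹) • P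

theorem boostMap_smul (P : Mom) {r : ℝ} (hr : 0 < r) {w : Mom} (hw : ‖w‖ = 1) :
    boostMap P (r • w) = boost P (2 * r) w := by
  have hn : ‖r • w‖ = r := by rw [norm_smul, hw, mul_one, Real.norm_of_nonneg hr.le]
  rw [boostMap, boost, hn, inner_smul_right, show (2 * r) ^ 2 = 4 * r ^ 2 by ring]
  have : 0 < Real.sqrt (‖P‖ ^ 2 + 4 * r ^ 2) := Real.sqrt_pos.2 (by positivity)
  congr 2
  · congr 1; ring
  · field_simp

theorem boostMap_eq_boost (P : Mom) {k : Mom} (hk : k ≠ 0) :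
    boostMap P k = boost P (2 * ‖k‖) (‖k‖⁻¹ • k) := by
  have h : 0 < ‖k‖ := norm_pos_iff.2 hk
  have hw : ‖‖k‖⁻¹ • k‖ = 1 := by rw [norm_smul, norm_inv, norm_norm, inv_mul_cancel₀ h.ne']
  rw [← boostMap_smul P h hw, smul_smul, mul_inv_cancel₀ h.ne', one_smul]

theorem sub_boost (P : Mom) (s : ℝ) (w : Mom) : P - boost P s w = boost P s (-w) := by
  rw [sub_eq_iff_eq_add, add_comm, boost_add_boost_neg]

theorem norm_inv_smul {k : Mom} (hk : k ≠ 0) : ‖‖k‖⁻¹ • k‖ = 1 := by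
  rw [norm_smul, norm_inv, norm_norm, inv_mul_cancel₀ (norm_ne_zero_iff.2 hk)]

theorem rho_boostMap (P : Mom) {k : Mom} (hk : k ≠ 0) :
    rho (boostMap P k) (P - boostMap P k) = 2 * ‖k‖ := by
  have h : 0 < ‖k‖ := norm_pos_iff.2 hk
  rw [boostMap_eq_boost P hk, sub_boost, rho_boost P (by positivity) (norm_inv_smul hk)]

theorem inner_boostMap (P : Mom) {k : Mom} (hk : k ≠ 0) :
    inner ℝ P (boostMap P k) = ‖P‖ ^ 2 / 2 +
      inner ℝ P k * (Real.sqrt (‖P‖ ^ 2 + 4 * ‖k‖ ^ 2) / (2 * ‖k‖)) := by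
  have h : 0 < ‖k‖ := norm_pos_iff.2 hk
  have hE : Real.sqrt (‖P‖ ^ 2 + 4 * ‖k‖ ^ 2) ^ 2 = ‖P‖ ^ 2 + 4 * ‖k‖ ^ 2 :=
    Real.sq_sqrt (by positivity)
  have hE0 : 0 < Real.sqrt (‖P‖ ^ 2 + 4 * ‖k‖ ^ 2) := Real.sqrt_pos.2 (by positivity)
  rw [boostMap]
  generalize Real.sqrt (‖P‖ ^ 2 + 4 * ‖k‖ ^ 2) = E at *
  rw [inner_add_right, inner_add_right, inner_smul_right, inner_smul_right,
    real_inner_self_eq_norm_sq, show ‖P‖ ^ 2 = E ^ 2 - 4 * ‖k‖ ^ 2 by linarith]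
  field_simp
  ring

/-- The value of `rho` recovers `‖k‖`, and then the inner product with `P` recovers `inner ℝ P k`.
These two numbers fix the multiple of `P` that is added to `k`. -/
theorem injOn_boostMap (P : Mom) : InjOn (boostMap P) {0}ᶜ := by
  intro k hk l hl h
  rw [mem_compl_singleton_iff] at hk hl
  have h1 := rho_boostMap P hk
  rw [h, rho_boostMap P hl] at h1
  have hn : ‖k‖ = ‖l‖ := by linarith
  have hi := inner_boostMap P hk
  rw [h, inner_boostMap P hl, hn] at hi
  have h : 0 < ‖l‖ := norm_pos_iff.2 hl
  have hE0 : 0 < Real.sqrt (‖P‖ ^ 2 + 4 * ‖l‖ ^ 2) := Real.sqrt_pos.2 (by positivity)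
  have hi' : inner ℝ P k = inner ℝ P l :=
    (mul_right_cancel₀ (by positivity) (add_left_cancel hi)).symm
  have h2 : boostMap P k = boostMap P l := by assumption
  rw [boostMap, boostMap, hn, hi'] at h2
  exact add_left_cancel (add_right_cancel h2)

theorem image_boostMap (P : Mom) : boostMap P '' {0}ᶜ = {p | 0 < rho p (P - p)} := by
  ext p
  constructor
  · rintro ⟨k, hk, rfl⟩
    rw [mem_ofPred_eq, rho_boostMap P hk]
    have := norm_pos_iff.2 hk
    positivity
  · intro hp
    rw [mem_ofPred_eq] at hp
    have hE := norm_add_sq_add_rho_sq p (P - p)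
    rw [add_sub_cancel] at hE
    set E := ‖p‖ + ‖P - p‖ with hEd
    set s := rho p (P - p)
    have hE0 : 0 < E := by
      have : 0 ≤ E := by positivity
      have : 0 < E ^ 2 := by rw [← hE]; positivity
      by_contra h0
      have : E = 0 := by linarith
      simp [this] at *
    have hd : ‖P - p‖ ^ 2 = ‖P‖ ^ 2 - 2 * inner ℝ P p + ‖p‖ ^ 2 := norm_sub_sq_real P p
    have hx : inner ℝ P p = ‖P‖ ^ 2 / 2 + E * (‖p‖ - ‖P - p‖) / 2 := by
      rw [hEd]; linear_combination (1 / 2) * hd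
    set x := inner ℝ P p - ‖P‖ ^ 2 / 2 with hxd
    -- The inverse boost: solving `boostMap P k = p` with `‖k‖ = s / 2` forces `inner ℝ P k = x * s
    -- / E`, hence this multiple of `P`.
    set k := p - (1 / 2 : ℝ) • P - (x / (E * (E + s))) • P with hk
    have hPk : inner ℝ P k = x * s / E := by
      rw [hk, inner_sub_right, inner_sub_right, inner_smul_right, inner_smul_right,
        real_inner_self_eq_norm_sq]
      have e1 : inner ℝ P p = x + ‖P‖ ^ 2 / 2 := by rw [hxd]; ring
      rw [e1, show ‖P‖ ^ 2 = E ^ 2 - s ^ 2 by linarith]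
      field_simp
      ring
    have hnk : ‖k‖ = s / 2 := by
      rw [← sq_eq_sq₀ (norm_nonneg _) (by positivity)]
      have hk' : k = p - ((1 / 2 : ℝ) + x / (E * (E + s))) • P := by rw [hk]; module
      rw [hk', norm_sub_sq_real, norm_smul, inner_smul_right, mul_pow, Real.norm_eq_abs, sq_abs,
        real_inner_comm]
      have e1 : inner ℝ P p = x + ‖P‖ ^ 2 / 2 := by rw [hxd]; ring
      have e2 : ‖p‖ = E / 2 + x / E := by
        have : x = E * (‖p‖ - ‖P - p‖) / 2 := by rw [hxd, hx]; ring
        rw [this]; field_simp; rw [hEd]; ring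
      rw [e1, e2, show ‖P‖ ^ 2 = E ^ 2 - s ^ 2 by linarith]
      field_simp
      ring
    refine ⟨k, ?_, ?_⟩
    · rw [mem_compl_singleton_iff, ← norm_pos_iff, hnk]; positivity
    · rw [boostMap, hnk, hPk, show ‖P‖ ^ 2 + 4 * (s / 2) ^ 2 = E ^ 2 by linarith,
        Real.sqrt_sq hE0.le, hk]
      have : x * s / E * (2 * (s / 2) * (E + 2 * (s / 2)))⁻¹ = x / (E * (E + s)) := by
        field_simp
      rw [this]
      module

/-- The Jacobian determinant of `boostMap`. -/
def boostJac (P k : Mom) : ℝ :=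
  (‖P‖ ^ 2 + 4 * ‖k‖ ^ 2 - (inner ℝ P k / ‖k‖) ^ 2) /
    (2 * ‖k‖ * Real.sqrt (‖P‖ ^ 2 + 4 * ‖k‖ ^ 2))

/-- The boost is `k` plus a constant plus a scalar function times the fixed vector `P`. Its
derivative is a rank-one perturbation of the identity, whose determinant needs only the slope of
that scalar function along `P`. -/
theorem boostMap_slope_hasDerivAt (P : Mom) {k : Mom} (hk : k ≠ 0) :
    HasDerivAt (fun t : ℝ => inner ℝ P (k + t • P) *
      (2 * ‖k + t • P‖ * (Real.sqrt (‖P‖ ^ 2 + 4 * ‖k + t • P‖ ^ 2) + 2 * ‖k + t • P‖))⁻¹)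
      (boostJac P k - 1) 0 := by
  have hn : 0 < ‖k‖ := norm_pos_iff.2 hk
  have hN : ∀ t : ℝ, ‖k + t • P‖ ^ 2 = ‖k‖ ^ 2 + 2 * t * inner ℝ P k + t ^ 2 * ‖P‖ ^ 2 := by
    intro t
    rw [norm_add_sq_real, inner_smul_right, norm_smul, mul_pow, Real.norm_eq_abs, sq_abs,
      real_inner_comm]
    ring
  have hN' : ∀ t : ℝ, ‖k + t • P‖ =
      Real.sqrt (‖k‖ ^ 2 + 2 * t * inner ℝ P k + t ^ 2 * ‖P‖ ^ 2) := by
    intro t; rw [← hN, Real.sqrt_sq (norm_nonneg _)]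
  have hI : ∀ t : ℝ, inner ℝ P (k + t • P) = inner ℝ P k + t * ‖P‖ ^ 2 := by
    intro t; rw [inner_add_right, inner_smul_right, real_inner_self_eq_norm_sq]
  simp only [hN', hI]
  have hsq : ∀ t : ℝ, 0 ≤ ‖k‖ ^ 2 + 2 * t * inner ℝ P k + t ^ 2 * ‖P‖ ^ 2 := by
    intro t; rw [← hN]; positivity
  simp only [fun t : ℝ => Real.sq_sqrt (hsq t)]
  rw [boostJac]
  generalize (inner ℝ P k : ℝ) = x at *
  have dN : HasDerivAt (fun t : ℝ => ‖k‖ ^ 2 + 2 * t * x + t ^ 2 * ‖P‖ ^ 2) (2 * x) 0 := by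
    refine HasDerivAt.congr_deriv ((((hasDerivAt_id' (0 : ℝ)).const_mul 2).mul_const x).const_add
      (‖k‖ ^ 2) |>.add (((hasDerivAt_id' (0 : ℝ)).pow 2).mul_const (‖P‖ ^ 2))) ?_
    simp
  have v0 : ‖k‖ ^ 2 + 2 * 0 * x + 0 ^ 2 * ‖P‖ ^ 2 = ‖k‖ ^ 2 := by ring
  have dn := dN.sqrt (by rw [v0]; positivity)
  have dE := ((dN.const_mul 4).const_add (‖P‖ ^ 2)).sqrt (by rw [v0]; positivity)
  have dI : HasDerivAt (fun t : ℝ => x + t * ‖P‖ ^ 2) (‖P‖ ^ 2) 0 := by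
    simpa using ((hasDerivAt_id (0 : ℝ)).mul_const (‖P‖ ^ 2)).const_add x
  have hE : Real.sqrt (‖P‖ ^ 2 + 4 * ‖k‖ ^ 2) ^ 2 = ‖P‖ ^ 2 + 4 * ‖k‖ ^ 2 :=
    Real.sq_sqrt (by positivity)
  have hE0 : 0 < Real.sqrt (‖P‖ ^ 2 + 4 * ‖k‖ ^ 2) := Real.sqrt_pos.2 (by positivity)
  have dD := ((dn.const_mul 2).mul (dE.add (dn.const_mul 2))).inv (by
    simp only [Pi.add_apply, Pi.mul_apply]
    rw [v0, Real.sqrt_sq hn.le]; positivity)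
  have := dI.mul dD
  refine this.congr_deriv ?_
  simp only [Pi.add_apply, Pi.mul_apply, Pi.inv_apply]
  rw [v0, Real.sqrt_sq hn.le]
  generalize Real.sqrt (‖P‖ ^ 2 + 4 * ‖k‖ ^ 2) = E at *
  rw [show ‖P‖ ^ 2 = E ^ 2 - 4 * ‖k‖ ^ 2 by linarith]
  field_simp
  ring

theorem hasFDerivAt_boostMap (P : Mom) {k : Mom} (hk : k ≠ 0) :
    ∃ L : Mom →L[ℝ] Mom, HasFDerivAt (boostMap P) L k ∧ L.det = boostJac P k := by
  have hn : 0 < ‖k‖ := norm_pos_iff.2 hk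
  have hE0 : 0 < Real.sqrt (‖P‖ ^ 2 + 4 * ‖k‖ ^ 2) := Real.sqrt_pos.2 (by positivity)
  let φ : Mom → ℝ := fun k => inner ℝ P k *
    (2 * ‖k‖ * (Real.sqrt (‖P‖ ^ 2 + 4 * ‖k‖ ^ 2) + 2 * ‖k‖))⁻¹
  have hd : DifferentiableAt ℝ φ k := by
    have h1 : DifferentiableAt ℝ (fun k : Mom => ‖k‖) k := differentiableAt_id.norm ℝ hk
    have h2 : DifferentiableAt ℝ (fun k : Mom => Real.sqrt (‖P‖ ^ 2 + 4 * ‖k‖ ^ 2)) k :=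
      (((h1.pow 2).const_mul 4).const_add _).sqrt
        (ne_of_gt (show 0 < ‖P‖ ^ 2 + 4 * ‖k‖ ^ 2 by positivity))
    have h3 : DifferentiableAt ℝ (fun k : Mom => (inner ℝ P k : ℝ)) k :=
      (innerSL ℝ P).differentiableAt
    exact h3.mul (((h1.const_mul 2).mul (h2.add (h1.const_mul 2))).inv
      (ne_of_gt (show 0 < 2 * ‖k‖ * (Real.sqrt (‖P‖ ^ 2 + 4 * ‖k‖ ^ 2) + 2 * ‖k‖) by positivity)))
  have hφ := hd.hasFDerivAt
  have hval : fderiv ℝ φ k P = boostJac P k - 1 := by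
    have hline : HasDerivAt (fun t : ℝ => k + t • P) P 0 := by
      simpa using ((hasDerivAt_id (0 : ℝ)).smul_const P).const_add k
    have h0 : HasFDerivAt φ (fderiv ℝ φ k) (k + (0 : ℝ) • P) := by simpa using hφ
    have h1 : HasDerivAt (fun t : ℝ => φ (k + t • P)) (fderiv ℝ φ k P) 0 :=
      HasFDerivAt.comp_hasDerivAt (f := fun t : ℝ => k + t • P) (l := φ) (0 : ℝ) h0 hline
    exact h1.unique (boostMap_slope_hasDerivAt P hk)
  refine ⟨ContinuousLinearMap.id ℝ Mom + (fderiv ℝ φ k).smulRight P, ?_, ?_⟩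
  · exact ((hasFDerivAt_id k).const_add ((1 / 2 : ℝ) • P)).add (hφ.smul_const P)
  -- The derivative `v ↦ v + dφ(v) P` is a transvection, with determinant `1 + dφ(P)`.
  · have : ((ContinuousLinearMap.id ℝ Mom + (fderiv ℝ φ k).smulRight P : Mom →L[ℝ] Mom) :
        Mom →ₗ[ℝ] Mom) = LinearMap.transvection (fderiv ℝ φ k : Mom →ₗ[ℝ] ℝ) P := by
      ext v
      simp [LinearMap.transvection]
    rw [ContinuousLinearMap.det, this, LinearMap.transvection.det]
    simp [hval]

theorem lintegral_boostMap (P : Mom) (F : Mom → ENNReal) :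
    ∫⁻ p in {p | 0 < rho p (P - p)}, F p =
      ∫⁻ k, ENNReal.ofReal |boostJac P k| * F (boostMap P k) := by
  choose! L hL hdet using fun k => hasFDerivAt_boostMap P (k := k)
  rw [← image_boostMap, lintegral_image_eq_lintegral_abs_det_fderiv_mul volume
    (measurableSet_singleton 0).compl (f' := L) (fun k hk => (hL k hk).hasFDerivWithinAt)
    (injOn_boostMap P) F]
  have : (volume : Measure Mom).restrict {0}ᶜ = volume := restrict_compl_singleton 0
  conv_rhs => rw [← this]
  refine setLIntegral_congr_fun (measurableSet_singleton 0).compl fun k hk => ?_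
  simp only [hdet k hk]

/-- Integration in polar coordinates. -/
theorem lintegral_polar (F : Mom → ENNReal) (hF : Measurable F) :
    ∫⁻ k, F k = ∫⁻ r in Ioi (0 : ℝ), ENNReal.ofReal (r ^ 2) *
      ∫⁻ w, F (r • (w : Mom)) ∂sphereMeasure := by
  have hmp := (volume : Measure Mom).measurePreserving_homeomorphUnitSphereProd
  have hdim : Module.finrank ℝ Mom - 1 = 2 := by simp
  rw [hdim] at hmp
  have hG : Measurable fun x : S2 × Ioi (0 : ℝ) => F ((x.2 : ℝ) • (x.1 : Mom)) :=
    hF.comp (by fun_prop)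
  calc ∫⁻ k, F k = ∫⁻ k in {0}ᶜ, F k := by rw [restrict_compl_singleton]
    _ = ∫⁻ k : ({0}ᶜ : Set Mom), F k ∂(Measure.comap Subtype.val volume) :=
      (lintegral_subtype_comap (measurableSet_singleton 0).compl _).symm
    _ = ∫⁻ x, F ((x.2 : ℝ) • (x.1 : Mom)) ∂(sphereMeasure.prod (Measure.volumeIoiPow 2)) := by
      rw [← hmp.lintegral_comp hG]
      refine lintegral_congr fun k => ?_
      have hk : ‖(k : Mom)‖ ≠ 0 := norm_ne_zero_iff.2 k.2
      simp [smul_smul, mul_inv_cancel₀ hk]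
    _ = ∫⁻ r, ∫⁻ w, F ((r : ℝ) • (w : Mom)) ∂sphereMeasure ∂(Measure.volumeIoiPow 2) := by
      rw [lintegral_prod_symm' _ hG]
    _ = _ := by
      have h1 : Measurable fun r : ℝ => ∫⁻ w, F (r • (w : Mom)) ∂sphereMeasure :=
        Measurable.lintegral_prod_right' (f := fun x : ℝ × S2 => F (x.1 • (x.2 : Mom)))
          (hF.comp (by fun_prop))
      refine (lintegral_withDensity_eq_lintegral_mul _ (by fun_prop)
        (h1.comp measurable_subtype_coe)).trans ?_
      exact lintegral_subtype_comap measurableSet_Ioi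
        (fun r : ℝ => ENNReal.ofReal (r ^ 2) * ∫⁻ w, F (r • (w : Mom)) ∂sphereMeasure)

/-! ### Integration over collisions and the exchange of incoming and outgoing pairs. -/

/-- The weight of the momentum pairs with total momentum `P` and relative momentum `2 r`. -/
def pairWeight (b ε : ℝ) (P : Mom) (r : ℝ) : ENNReal :=
  if ε ≤ 2 * r then ENNReal.ofReal (2 * r / Real.sqrt (‖P‖ ^ 2 + 4 * r ^ 2) * (2 * r) ^ (2 - b))
  else 0

@[fun_prop]
theorem _root_.Measurable.rho {α : Type*} [MeasurableSpace α] {f g : α → Mom} (hf : Measurable f)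
    (hg : Measurable g) : Measurable fun x => rho (f x) (g x) := by
  unfold MasslessBoltzmann.rho; fun_prop

@[fun_prop]
theorem _root_.Measurable.cutKernel {α : Type*} [MeasurableSpace α] (b ε : ℝ) {f g : α → Mom}
    (hf : Measurable f) (hg : Measurable g) : Measurable fun x => cutKernel b ε (f x) (g x) := by
  unfold MasslessBoltzmann.cutKernel
  exact Measurable.ite (measurableSet_le measurable_const (hf.rho hg)) (by fun_prop)
    measurable_const

@[fun_prop]
theorem _root_.Measurable.outP {α : Type*} [MeasurableSpace α] {f g h : α → Mom} (hf : Measurable f)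
    (hg : Measurable g) (hh : Measurable h) : Measurable fun x => outP (f x) (g x) (h x) := by
  unfold MasslessBoltzmann.outP; fun_prop

@[fun_prop]
theorem _root_.Measurable.outQ {α : Type*} [MeasurableSpace α] {f g h : α → Mom} (hf : Measurable f)
    (hg : Measurable g) (hh : Measurable h) : Measurable fun x => outQ (f x) (g x) (h x) := by
  unfold MasslessBoltzmann.outQ; fun_prop

@[fun_prop]
theorem _root_.Measurable.boost {α : Type*} [MeasurableSpace α] (P : Mom) (s : ℝ) {f : α → Mom}
    (hf : Measurable f) : Measurable fun x => boost P s (f x) := by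
  unfold MasslessBoltzmann.boost; fun_prop

theorem cutKernel_nonneg (b ε : ℝ) (p q : Mom) : 0 ≤ cutKernel b ε p q := by
  unfold cutKernel
  split_ifs
  · exact div_nonneg (Real.rpow_nonneg (rho_nonneg p q) _) (by positivity)
  · exact le_rfl

theorem measurable_boostMap (P : Mom) : Measurable (boostMap P) := by
  unfold boostMap; fun_prop

theorem measurable_boostJac (P : Mom) : Measurable (boostJac P) := by
  unfold boostJac; fun_prop

/-- The decisive cancellation: the Jacobian and the product of the two energies contain the same
factor `E² - (P·w)²`, so no dependence on `w` is left. -/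
theorem boostJac_mul_cutKernel {b ε : ℝ} (P : Mom) {r : ℝ} (hr : 0 < r) {w : Mom}
    (hw : ‖w‖ = 1) :
    ENNReal.ofReal (r ^ 2) * (ENNReal.ofReal |boostJac P (r • w)| *
      ENNReal.ofReal (cutKernel b ε (boost P (2 * r) w) (boost P (2 * r) (-w)))) =
      pairWeight b ε P r := by
  have h2r : 0 < 2 * r := by positivity
  rw [cutKernel, rho_boost P h2r hw, norm_boost_mul_norm_boost_neg P h2r hw, pairWeight]
  split_ifs with h
  · have hn : ‖r • w‖ = r := by rw [norm_smul, hw, mul_one, Real.norm_of_nonneg hr.le]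
    have hx : (inner ℝ P w) ^ 2 ≤ ‖P‖ ^ 2 := by
      have := abs_real_inner_le_norm P w
      rw [hw, mul_one] at this
      exact sq_le_sq' (abs_le.1 this).1 (abs_le.1 this).2
    have hpos : 0 < ‖P‖ ^ 2 + 4 * r ^ 2 - inner ℝ P w ^ 2 := by nlinarith
    have hE : 0 < Real.sqrt (‖P‖ ^ 2 + 4 * r ^ 2) := Real.sqrt_pos.2 (by positivity)
    have hxr : inner ℝ P (r • w) / r = inner ℝ P w := by
      rw [inner_smul_right]; field_simp
    rw [boostJac, hn, hxr, abs_of_nonneg (by positivity), ← ENNReal.ofReal_mul (by positivity),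
      ← ENNReal.ofReal_mul (by positivity), show (2 * r) ^ 2 = 4 * r ^ 2 by ring]
    congr 1
    generalize ‖P‖ ^ 2 + 4 * r ^ 2 - inner ℝ P w ^ 2 = D at *
    field_simp
    ring
  · simp

/-- Substitute `q = P - p`, exchange the integrals, and at fixed `P` pass from `p` to `k` and then
to polar coordinates. The boost misses the pairs with `rho = 0`, where `H` vanishes by assumption.
-/
theorem lintegral_pair_eq_lintegral_boost {H : Mom × Mom → ENNReal} (hH : Measurable H)
    (h0 : ∀ p q, ¬ 0 < rho p q → H (p, q) = 0) :
    ∫⁻ p, ∫⁻ q, H (p, q) =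
      ∫⁻ P : Mom, ∫⁻ r in Ioi (0 : ℝ), ENNReal.ofReal (r ^ 2) *
        ∫⁻ w, ENNReal.ofReal |boostJac P (r • (w : Mom))| *
          H (boostMap P (r • (w : Mom)), P - boostMap P (r • (w : Mom))) ∂sphereMeasure := by
  have h1 : ∀ p : Mom, ∫⁻ q, H (p, q) = ∫⁻ P : Mom, H (p, P - p) := fun p =>
    (lintegral_sub_right_eq_self (fun q => H (p, q)) p).symm
  have hsw : ∫⁻ p : Mom, ∫⁻ P : Mom, H (p, P - p) = ∫⁻ P : Mom, ∫⁻ p : Mom, H (p, P - p) := by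
    refine lintegral_lintegral_swap (f := fun p P => H (p, P - p)) (Measurable.aemeasurable ?_)
    exact hH.comp (by fun_prop : Measurable fun x : Mom × Mom => (x.1, x.2 - x.1))
  rw [lintegral_congr h1, hsw]
  refine lintegral_congr fun P => ?_
  have hs : MeasurableSet {p : Mom | 0 < rho p (P - p)} :=
    measurableSet_lt measurable_const (by fun_prop)
  have h2 : ∫⁻ p : Mom, H (p, P - p) = ∫⁻ p in {p : Mom | 0 < rho p (P - p)}, H (p, P - p) := by
    rw [← lintegral_indicator hs]
    refine lintegral_congr fun p => ?_
    by_cases hp : p ∈ {p : Mom | 0 < rho p (P - p)}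
    · rw [indicator_of_mem hp]
    · rw [indicator_of_notMem hp, h0 _ _ hp]
  have hm := measurable_boostMap P
  have hF : Measurable fun k => ENNReal.ofReal |boostJac P k| *
      H (boostMap P k, P - boostMap P k) :=
    (measurable_boostJac P).abs.ennreal_ofReal.mul (hH.comp (by fun_prop))
  rw [h2, lintegral_boostMap P fun p => H (p, P - p), lintegral_polar _ hF]

theorem lintegral_pair (b : ℝ) {ε : ℝ} (hε : 0 < ε) {G : Mom × Mom → ENNReal} (hG : Measurable G) :
    ∫⁻ p, ∫⁻ q, ENNReal.ofReal (cutKernel b ε p q) * G (p, q) =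
      ∫⁻ P : Mom, ∫⁻ r in Ioi (0 : ℝ), pairWeight b ε P r *
        ∫⁻ w, G (boost P (2 * r) w, boost P (2 * r) (-(w : Mom))) ∂sphereMeasure := by
  have hH : Measurable fun x : Mom × Mom => ENNReal.ofReal (cutKernel b ε x.1 x.2) * G x := by
    fun_prop
  have h0 : ∀ p q, ¬ 0 < rho p q → ENNReal.ofReal (cutKernel b ε p q) * G (p, q) = 0 := by
    intro p q hp
    have : ¬ ε ≤ rho p q := fun h => hp (hε.trans_le h)
    simp [cutKernel, this]
  refine (lintegral_pair_eq_lintegral_boost hH h0).trans (lintegral_congr fun P =>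
    setLIntegral_congr_fun measurableSet_Ioi fun r hr => ?_)
  have hr : 0 < r := hr
  have hm := measurable_boostMap P
  have hJ := measurable_boostJac P
  simp only
  rw [← lintegral_const_mul _ (by fun_prop), ← lintegral_const_mul _ (by fun_prop)]
  refine lintegral_congr fun w => ?_
  have hw : ‖(w : Mom)‖ = 1 := norm_eq_of_mem_sphere w
  rw [boostMap_smul P hr hw, sub_boost, ← boostJac_mul_cutKernel P hr hw]
  simp only [mul_assoc]

/-- At fixed `P` and `r` the angular integral of `B` does not depend on the incoming direction and
factors out. The product form is visibly symmetric in `A` and `B`. -/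
theorem lintegral_collision (b : ℝ) {ε : ℝ} (hε : 0 < ε) {A B : Mom × Mom → ENNReal}
    (hA : Measurable A) (hB : Measurable B) :
    ∫⁻ p, ∫⁻ q, ENNReal.ofReal (cutKernel b ε p q) *
        (A (p, q) * ∫⁻ w, B (outP p q (w : Mom), outQ p q (w : Mom)) ∂sphereMeasure) =
      ∫⁻ P : Mom, ∫⁻ r in Ioi (0 : ℝ), pairWeight b ε P r *
        ((∫⁻ w, A (boost P (2 * r) w, boost P (2 * r) (-(w : Mom))) ∂sphereMeasure) *
        ∫⁻ w, B (boost P (2 * r) w, boost P (2 * r) (-(w : Mom))) ∂sphereMeasure) := by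
  have hI : Measurable fun x : Mom × Mom =>
      ∫⁻ w, B (outP x.1 x.2 (w : Mom), outQ x.1 x.2 (w : Mom)) ∂sphereMeasure :=
    Measurable.lintegral_prod_right' (f := fun x : (Mom × Mom) × S2 =>
      B (outP x.1.1 x.1.2 (x.2 : Mom), outQ x.1.1 x.1.2 (x.2 : Mom))) (by fun_prop)
  have := lintegral_pair b hε (G := fun x => A x *
    ∫⁻ w, B (outP x.1 x.2 (w : Mom), outQ x.1 x.2 (w : Mom)) ∂sphereMeasure) (hA.mul hI)
  refine this.trans (lintegral_congr fun P => setLIntegral_congr_fun measurableSet_Ioi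
    fun r hr => ?_)
  have hr : 0 < 2 * r := mul_pos two_pos hr
  simp only
  rw [← lintegral_mul_const _ (by fun_prop)]
  congr 1
  refine lintegral_congr fun w => ?_
  have hw : ‖(w : Mom)‖ = 1 := norm_eq_of_mem_sphere w
  simp only [outP_boost P hr hw, outQ_boost P hr hw]

/-- The pre-post collisional change of variables. -/
theorem lintegral_collision_symm (b : ℝ) {ε : ℝ} (hε : 0 < ε) {A B : Mom × Mom → ENNReal}
    (hA : Measurable A) (hB : Measurable B) :
    ∫⁻ p, ∫⁻ q, ENNReal.ofReal (cutKernel b ε p q) *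
        (A (p, q) * ∫⁻ w, B (outP p q (w : Mom), outQ p q (w : Mom)) ∂sphereMeasure) =
    ∫⁻ p, ∫⁻ q, ENNReal.ofReal (cutKernel b ε p q) *
        (B (p, q) * ∫⁻ w, A (outP p q (w : Mom), outQ p q (w : Mom)) ∂sphereMeasure) := by
  rw [lintegral_collision b hε hA hB, lintegral_collision b hε hB hA]
  simp only [mul_comm]

/-! ### Bilinear integral operators on `L¹`. -/

section BilinearOperator

variable {X Y : Type*} [MeasurableSpace X] [MeasurableSpace Y]

/-- A nonnegative kernel `κ` on `X × Y` together with two maps `a, c : X × Y → X` such that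
`(f, g) ↦ ∫ κ(·, y) f(a(·, y)) g(c(·, y)) dy` is bounded on `L¹`. -/
structure IsBilinearKernel (μ : Measure X) (ν : Measure Y) (κ : X × Y → ℝ) (a c : X × Y → X)
    (C : ℝ) : Prop where
  measurable_kernel : Measurable κ
  kernel_nonneg : ∀ x, 0 ≤ κ x
  measurable_left : Measurable a
  measurable_right : Measurable c
  bound_nonneg : 0 ≤ C
  bound : ∀ f g : X → ENNReal, Measurable f → Measurable g →
    ∫⁻ x, ∫⁻ y, ENNReal.ofReal (κ (x, y)) * (f (a (x, y)) * g (c (x, y))) ∂ν ∂μ ≤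
      ENNReal.ofReal C * ((∫⁻ x, f x ∂μ) * ∫⁻ x, g x ∂μ)

namespace IsBilinearKernel

variable {μ : Measure X} {ν : Measure Y} {κ : X × Y → ℝ} {a c : X × Y → X}
  {C : ℝ}

theorem measurable_integrand (h : IsBilinearKernel μ ν κ a c C) {f g : X → ℝ} (hf : Measurable f)
    (hg : Measurable g) : Measurable fun x => κ x * (f (a x) * g (c x)) :=
  h.measurable_kernel.mul ((hf.comp h.measurable_left).mul (hg.comp h.measurable_right))

variable [SFinite ν]

theorem lintegral_enorm_le (h : IsBilinearKernel μ ν κ a c C) {f g : X → ℝ} (hf : Measurable f)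
    (hg : Measurable g) :
    ∫⁻ x, ‖κ x * (f (a x) * g (c x))‖ₑ ∂(μ.prod ν) ≤
      ENNReal.ofReal C * ((∫⁻ x, ‖f x‖ₑ ∂μ) * ∫⁻ x, ‖g x‖ₑ ∂μ) := by
  rw [lintegral_prod _ (h.measurable_integrand hf hg).enorm.aemeasurable]
  refine le_trans (le_of_eq ?_) (h.bound _ _ hf.enorm hg.enorm)
  refine lintegral_congr fun x => lintegral_congr fun y => ?_
  rw [enorm_mul, enorm_mul, Real.enorm_of_nonneg (h.kernel_nonneg _)]

theorem integrable_prod (h : IsBilinearKernel μ ν κ a c C) {f g : X → ℝ} (hf : Measurable f)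
    (hg : Measurable g) (hfi : Integrable f μ) (hgi : Integrable g μ) :
    Integrable (fun x => κ x * (f (a x) * g (c x))) (μ.prod ν) := by
  refine ⟨(h.measurable_integrand hf hg).aestronglyMeasurable, ?_⟩
  exact (h.lintegral_enorm_le hf hg).trans_lt
    (ENNReal.mul_lt_top ENNReal.ofReal_lt_top (ENNReal.mul_lt_top hfi.2 hgi.2))

/-- The `L¹` bound applied to the indicator of a null set shows that `a` hits this set only where
the kernel vanishes, up to a null set. This makes the operator well defined on classes of functions.
-/
theorem ae_kernel_eq_zero_or_left (h : IsBilinearKernel μ ν κ a c C) {N : Set X}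
    (hN : MeasurableSet N) (h0 : μ N = 0) : ∀ᵐ x ∂(μ.prod ν), κ x = 0 ∨ a x ∉ N := by
  have := h.bound (N.indicator 1) 1 (measurable_one.indicator hN) measurable_one
  rw [lintegral_indicator_one hN, h0, zero_mul, mul_zero] at this
  have hm : Measurable fun x => ENNReal.ofReal (κ x) *
      ((N.indicator 1 (a x) : ENNReal) * (1 : X → ENNReal) (c x)) :=
    h.measurable_kernel.ennreal_ofReal.mul
      (((measurable_one.indicator hN).comp h.measurable_left).mul measurable_const)
  rw [← lintegral_prod _ hm.aemeasurable] at this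
  have := (lintegral_eq_zero_iff hm).1 (le_antisymm this bot_le)
  filter_upwards [this] with x hx
  by_cases hxN : a x ∈ N
  · left
    simp only [indicator_of_mem hxN, Pi.one_apply, mul_one, Pi.zero_apply,
      ENNReal.ofReal_eq_zero] at hx
    exact le_antisymm hx (h.kernel_nonneg x)
  · exact Or.inr hxN

theorem ae_kernel_eq_zero_or_right (h : IsBilinearKernel μ ν κ a c C) {N : Set X}
    (hN : MeasurableSet N) (h0 : μ N = 0) : ∀ᵐ x ∂(μ.prod ν), κ x = 0 ∨ c x ∉ N := by
  have h' : IsBilinearKernel μ ν κ c a C :=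
    ⟨h.measurable_kernel, h.kernel_nonneg, h.measurable_right, h.measurable_left, h.bound_nonneg,
      fun f g hf hg => by
        have := h.bound g f hg hf
        rw [mul_comm (∫⁻ x, f x ∂μ)]
        simpa only [mul_comm (f _)] using this⟩
  exact h'.ae_kernel_eq_zero_or_left hN h0

theorem integrand_congr (h : IsBilinearKernel μ ν κ a c C) {f f' g g' : X → ℝ} (hf : f =ᵐ[μ] f')
    (hg : g =ᵐ[μ] g') : (fun x => κ x * (f (a x) * g (c x))) =ᵐ[μ.prod ν]
      fun x => κ x * (f' (a x) * g' (c x)) := by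
  obtain ⟨N, hN, hNm, hN0⟩ := exists_measurable_superset_of_null (ae_iff.1 hf)
  obtain ⟨M, hM, hMm, hM0⟩ := exists_measurable_superset_of_null (ae_iff.1 hg)
  filter_upwards [h.ae_kernel_eq_zero_or_left hNm hN0, h.ae_kernel_eq_zero_or_right hMm hM0]
    with x hx hx'
  rcases hx with hx | hx
  · simp [hx]
  rcases hx' with hx' | hx'
  · simp [hx']
  have h1 : f (a x) = f' (a x) := by by_contra hne; exact hx (hN hne)
  have h2 : g (c x) = g' (c x) := by by_contra hne; exact hx' (hM hne)
  rw [h1, h2]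

theorem integrable_L1 (h : IsBilinearKernel μ ν κ a c C) (f g : Lp ℝ 1 μ) :
    Integrable (fun x => κ x * (f (a x) * g (c x))) (μ.prod ν) :=
  h.integrable_prod (Lp.stronglyMeasurable f).measurable (Lp.stronglyMeasurable g).measurable
    (L1.integrable_coeFn f) (L1.integrable_coeFn g)

/-- The value of the bilinear operator as an element of `L¹`. -/
def toL1 (h : IsBilinearKernel μ ν κ a c C) (f g : Lp ℝ 1 μ) : Lp ℝ 1 μ :=
  (h.integrable_L1 f g).integral_prod_left.toL1 _

theorem coeFn_toL1 (h : IsBilinearKernel μ ν κ a c C) (f g : Lp ℝ 1 μ) :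
    h.toL1 f g =ᵐ[μ] fun x => ∫ y, κ (x, y) * (f (a (x, y)) * g (c (x, y))) ∂ν :=
  Integrable.coeFn_toL1 _

theorem coeFn_toL1_of_ae_eq (h : IsBilinearKernel μ ν κ a c C) (f g : Lp ℝ 1 μ) {u v : X → ℝ}
    (hu : f =ᵐ[μ] u) (hv : g =ᵐ[μ] v) :
    h.toL1 f g =ᵐ[μ] fun x => ∫ y, κ (x, y) * (u (a (x, y)) * v (c (x, y))) ∂ν := by
  refine (h.coeFn_toL1 f g).trans ?_
  filter_upwards [Measure.ae_ae_of_ae_prod (h.integrand_congr hu hv)] with x hx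
  exact integral_congr_ae hx

theorem toL1_add_left [SFinite μ] (h : IsBilinearKernel μ ν κ a c C) (f f' g : Lp ℝ 1 μ) :
    h.toL1 (f + f') g = h.toL1 f g + h.toL1 f' g := by
  refine Lp.ext ?_
  filter_upwards [h.coeFn_toL1_of_ae_eq (f + f') g (Lp.coeFn_add f f') (ae_eq_refl _),
    Lp.coeFn_add (h.toL1 f g) (h.toL1 f' g), h.coeFn_toL1 f g, h.coeFn_toL1 f' g,
    (h.integrable_L1 f g).prod_right_ae, (h.integrable_L1 f' g).prod_right_ae]
    with x h1 h2 h3 h4 h5 h6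
  rw [h1, h2, Pi.add_apply, h3, h4, ← integral_add h5 h6]
  simp only [Pi.add_apply, add_mul, mul_add]

theorem toL1_add_right [SFinite μ] (h : IsBilinearKernel μ ν κ a c C) (f g g' : Lp ℝ 1 μ) :
    h.toL1 f (g + g') = h.toL1 f g + h.toL1 f g' := by
  refine Lp.ext ?_
  filter_upwards [h.coeFn_toL1_of_ae_eq f (g + g') (ae_eq_refl _) (Lp.coeFn_add g g'),
    Lp.coeFn_add (h.toL1 f g) (h.toL1 f g'), h.coeFn_toL1 f g, h.coeFn_toL1 f g',
    (h.integrable_L1 f g).prod_right_ae, (h.integrable_L1 f g').prod_right_ae]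
    with x h1 h2 h3 h4 h5 h6
  rw [h1, h2, Pi.add_apply, h3, h4, ← integral_add h5 h6]
  simp only [Pi.add_apply, mul_add]

theorem toL1_smul_left (h : IsBilinearKernel μ ν κ a c C) (r : ℝ) (f g : Lp ℝ 1 μ) :
    h.toL1 (r • f) g = r • h.toL1 f g := by
  refine Lp.ext ?_
  filter_upwards [h.coeFn_toL1_of_ae_eq (r • f) g (Lp.coeFn_smul r f) (ae_eq_refl _),
    Lp.coeFn_smul r (h.toL1 f g), h.coeFn_toL1 f g] with x h1 h2 h3
  rw [h1, h2, Pi.smul_apply, h3, smul_eq_mul, ← integral_const_mul]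
  simp only [Pi.smul_apply, smul_eq_mul]
  congr 1; ext y; ring

theorem toL1_smul_right (h : IsBilinearKernel μ ν κ a c C) (r : ℝ) (f g : Lp ℝ 1 μ) :
    h.toL1 f (r • g) = r • h.toL1 f g := by
  refine Lp.ext ?_
  filter_upwards [h.coeFn_toL1_of_ae_eq f (r • g) (ae_eq_refl _) (Lp.coeFn_smul r g),
    Lp.coeFn_smul r (h.toL1 f g), h.coeFn_toL1 f g] with x h1 h2 h3
  rw [h1, h2, Pi.smul_apply, h3, smul_eq_mul, ← integral_const_mul]
  simp only [Pi.smul_apply, smul_eq_mul]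
  congr 1; ext y; ring

theorem norm_toL1_le (h : IsBilinearKernel μ ν κ a c C) (f g : Lp ℝ 1 μ) :
    ‖h.toL1 f g‖ ≤ C * ‖f‖ * ‖g‖ := by
  have h1 : ‖h.toL1 f g‖ₑ ≤ ENNReal.ofReal C * (‖f‖ₑ * ‖g‖ₑ) := by
    have hf := (Lp.stronglyMeasurable f).measurable
    have hg := (Lp.stronglyMeasurable g).measurable
    rw [Lp.enorm_def, Lp.enorm_def, Lp.enorm_def, eLpNorm_congr_ae (h.coeFn_toL1 f g)]
    simp only [eLpNorm_one_eq_lintegral_enorm]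
    refine le_trans ?_ (h.lintegral_enorm_le hf hg)
    rw [lintegral_prod _ (h.measurable_integrand hf hg).enorm.aemeasurable]
    exact lintegral_mono fun x => enorm_integral_le_lintegral_enorm _
  rw [← ofReal_norm, ← ofReal_norm, ← ofReal_norm, ← ENNReal.ofReal_mul (norm_nonneg _),
    ← ENNReal.ofReal_mul h.bound_nonneg] at h1
  rw [mul_assoc]
  exact (ENNReal.ofReal_le_ofReal_iff
    (mul_nonneg h.bound_nonneg (mul_nonneg (norm_nonneg _) (norm_nonneg _)))).1 h1

variable [SFinite μ]

/-- The continuous bilinear operator on `L¹` of a kernel. -/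
def clm (h : IsBilinearKernel μ ν κ a c C) : Lp ℝ 1 μ →L[ℝ] Lp ℝ 1 μ →L[ℝ] Lp ℝ 1 μ :=
  LinearMap.mkContinuous₂ (LinearMap.mk₂ ℝ h.toL1 h.toL1_add_left h.toL1_smul_left h.toL1_add_right
    h.toL1_smul_right) C h.norm_toL1_le

theorem clm_apply (h : IsBilinearKernel μ ν κ a c C) (f g : Lp ℝ 1 μ) : h.clm f g = h.toL1 f g :=
  rfl

theorem lintegral_mul_clm (h : IsBilinearKernel μ ν κ a c C) {f g : Lp ℝ 1 μ} (hf : 0 ≤ f)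
    (hg : 0 ≤ g) (W : X → ENNReal) :
    ∫⁻ x, W x * ENNReal.ofReal (h.clm f g x) ∂μ =
      ∫⁻ x, ∫⁻ y, ENNReal.ofReal (κ (x, y)) *
        (W x * (ENNReal.ofReal (f (a (x, y))) * ENNReal.ofReal (g (c (x, y))))) ∂ν ∂μ := by
  -- Passing to everywhere nonnegative representatives gives a pointwise sign after composition with
  -- `a` and `c`, for which almost everywhere statements are awkward.
  have hf0 : ∀ᵐ x ∂μ, max (f x) 0 = f x := by
    filter_upwards [(Lp.coeFn_nonneg f).2 hf] with x hx
    exact max_eq_left hx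
  have hg0 : ∀ᵐ x ∂μ, max (g x) 0 = g x := by
    filter_upwards [(Lp.coeFn_nonneg g).2 hg] with x hx
    exact max_eq_left hx
  have hfm := (Lp.stronglyMeasurable f).measurable
  have hgm := (Lp.stronglyMeasurable g).measurable
  have hint := (h.integrable_L1 f g).congr
    (h.integrand_congr (ae_eq_symm hf0) (ae_eq_symm hg0))
  refine lintegral_congr_ae ?_
  filter_upwards [h.coeFn_toL1_of_ae_eq f g (ae_eq_symm hf0) (ae_eq_symm hg0),
    hint.prod_right_ae] with x hx hx'
  have hnn : ∀ y, 0 ≤ κ (x, y) * (max (f (a (x, y))) 0 * max (g (c (x, y))) 0) := fun y =>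
    mul_nonneg (h.kernel_nonneg _) (mul_nonneg (le_max_right _ _) (le_max_right _ _))
  rw [clm_apply, hx, ofReal_integral_eq_lintegral_ofReal hx' (Filter.Eventually.of_forall hnn),
    ← lintegral_const_mul]
  · refine lintegral_congr fun y => ?_
    rw [ENNReal.ofReal_mul (h.kernel_nonneg _), ENNReal.ofReal_mul (le_max_right _ _),
      ENNReal.ofReal_max, ENNReal.ofReal_max, ENNReal.ofReal_zero, max_eq_left zero_le,
      max_eq_left zero_le, mul_left_comm]
  · exact ((h.measurable_integrand (hfm.max measurable_const) (hgm.max measurable_const)).comp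
      measurable_prodMk_left).ennreal_ofReal

theorem clm_nonneg (h : IsBilinearKernel μ ν κ a c C) {f g : Lp ℝ 1 μ} (hf : 0 ≤ f)
    (hg : 0 ≤ g) : 0 ≤ h.clm f g := by
  rw [← Lp.coeFn_nonneg]
  have hf0 : ∀ᵐ x ∂μ, max (f x) 0 = f x := by
    filter_upwards [(Lp.coeFn_nonneg f).2 hf] with x hx
    exact max_eq_left hx
  have hg0 : ∀ᵐ x ∂μ, max (g x) 0 = g x := by
    filter_upwards [(Lp.coeFn_nonneg g).2 hg] with x hx
    exact max_eq_left hx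
  filter_upwards [h.coeFn_toL1_of_ae_eq f g (ae_eq_symm hf0) (ae_eq_symm hg0)] with x hx
  rw [clm_apply, hx]
  exact integral_nonneg fun y =>
    mul_nonneg (h.kernel_nonneg _) (mul_nonneg (le_max_right _ _) (le_max_right _ _))

end IsBilinearKernel

end BilinearOperator

/-! ### The gain and loss operators. -/

/-- The measure `d³q dω`. -/
abbrev pairMeasure : Measure (Mom × S2) := (volume : Measure Mom).prod sphereMeasure

instance : SFinite pairMeasure := Measure.prod.instSFinite

/-- Since `rho² ≤ 4 ‖p‖ ‖q‖`, the kernel is at most `4 rho^(-b)`, and `rho ≥ ε` where it does not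
vanish. -/
theorem cutKernel_le {b ε : ℝ} (hb : 0 < b) (hε : 0 < ε) (p q : Mom) :
    cutKernel b ε p q ≤ 4 * ε ^ (-b) := by
  unfold cutKernel
  split_ifs with h
  · have hr : 0 < rho p q := hε.trans_le h
    have hpq := norm_mul_norm_pos_of_rho_pos hr
    have h1 : rho p q ^ (2 - b) = rho p q ^ 2 * rho p q ^ (-b) := by
      rw [← Real.rpow_natCast, ← Real.rpow_add hr]; norm_num; rfl
    have h2 : rho p q ^ (-b) ≤ ε ^ (-b) := Real.rpow_le_rpow_of_nonpos hε h (by linarith)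
    rw [div_le_iff₀ hpq, h1]
    have h3 := rho_sq_le p q
    calc rho p q ^ 2 * rho p q ^ (-b) ≤ (4 * (‖p‖ * ‖q‖)) * ε ^ (-b) := by gcongr
      _ = _ := by ring
  · positivity

/-- An upper bound for the total collision rate. -/
def rateBound (C₁ b ε : ℝ) : ℝ := C₁ * (4 * ε ^ (-b)) * sphereMeasure.real univ

theorem sphereMeasure_real_univ_pos : 0 < sphereMeasure.real univ := by
  rw [measureReal_def]
  exact ENNReal.toReal_pos (Measure.measure_univ_pos.2 (Measure.toSphere_ne_zero _)).ne' (measure_ne_top _ _)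

theorem rateBound_pos {C₁ b ε : ℝ} (hC : 0 < C₁) (hε : 0 < ε) : 0 < rateBound C₁ b ε := by
  have := sphereMeasure_real_univ_pos
  unfold rateBound
  positivity

/-- The weak form of the gain term: the exchange symmetry moves the collision from the densities to
the test function `W`. -/
theorem lintegral_gain (b : ℝ) {ε : ℝ} (hε : 0 < ε) {F G W : Mom → ENNReal} (hF : Measurable F)
    (hG : Measurable G) (hW : Measurable W) :
    ∫⁻ p, ∫⁻ y, ENNReal.ofReal (cutKernel b ε p y.1) *
      (W p * (F (outP p y.1 (y.2 : Mom)) * G (outQ p y.1 (y.2 : Mom)))) ∂pairMeasure =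
    ∫⁻ p, ∫⁻ q, ENNReal.ofReal (cutKernel b ε p q) *
      ((F p * G q) * ∫⁻ w, W (outP p q (w : Mom)) ∂sphereMeasure) := by
  have := lintegral_collision_symm b hε (A := fun x => W x.1) (B := fun x => F x.1 * G x.2)
    (by fun_prop) (by fun_prop)
  simp only at this
  rw [← this]
  refine lintegral_congr fun p => ?_
  rw [lintegral_prod _ (by fun_prop)]
  refine lintegral_congr fun q => ?_
  rw [← lintegral_const_mul _ (by fun_prop), ← lintegral_const_mul _ (by fun_prop)]

theorem lintegral_loss (b ε : ℝ) {G : Mom → ENNReal} (hG : Measurable G) (F W : Mom → ENNReal) :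
    ∫⁻ p, ∫⁻ y, ENNReal.ofReal (cutKernel b ε p y.1) * (W p * (F p * G y.1)) ∂pairMeasure =
    ∫⁻ p, ∫⁻ q, ENNReal.ofReal (cutKernel b ε p q) *
      ((F p * G q) * ∫⁻ _, W p ∂sphereMeasure) := by
  refine lintegral_congr fun p => ?_
  rw [lintegral_prod _ (by fun_prop)]
  refine lintegral_congr fun q => ?_
  simp only [lintegral_const]
  ring

theorem lintegral_cutKernel_mul_le {C₁ b ε : ℝ} (hC : 0 < C₁) (hb : 0 < b) (hε : 0 < ε)
    {F G : Mom → ENNReal} (hF : Measurable F) (hG : Measurable G) :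
    ENNReal.ofReal C₁ * ∫⁻ p, ∫⁻ q, ENNReal.ofReal (cutKernel b ε p q) *
      ((F p * G q) * ∫⁻ _, 1 ∂sphereMeasure) ≤
      ENNReal.ofReal (rateBound C₁ b ε) * ((∫⁻ p, F p) * ∫⁻ q, G q) := by
  have hs : ∫⁻ _, 1 ∂sphereMeasure = ENNReal.ofReal (sphereMeasure.real univ) := by
    rw [lintegral_one, ofReal_measureReal]
  calc _ ≤ ENNReal.ofReal C₁ * ∫⁻ p, ∫⁻ q, ENNReal.ofReal (4 * ε ^ (-b)) *
      ((F p * G q) * ∫⁻ _, 1 ∂sphereMeasure) := by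
        gcongr with p q; exact cutKernel_le hb hε p q
    _ = ENNReal.ofReal C₁ * (ENNReal.ofReal (4 * ε ^ (-b)) * (((∫⁻ p, F p) * ∫⁻ q, G q) *
          ENNReal.ofReal (sphereMeasure.real univ))) := by
        rw [hs]
        congr 1
        rw [← lintegral_mul_const _ hF, ← lintegral_mul_const _ (by fun_prop),
          ← lintegral_const_mul _ (by fun_prop)]
        refine lintegral_congr fun p => ?_
        rw [← lintegral_const_mul _ hG, ← lintegral_mul_const _ (by fun_prop),
          ← lintegral_const_mul _ (by fun_prop)]
    _ = _ := by
        rw [rateBound, ENNReal.ofReal_mul (p := C₁ * (4 * ε ^ (-b))) (by positivity),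
          ENNReal.ofReal_mul hC.le]
        ring

theorem lintegral_ofReal_const_mul_left {C₁ : ℝ} (hC : 0 < C₁) (k : Mom → Mom × S2 → ℝ)
    (φ : Mom → Mom × S2 → ENNReal) :
    ∫⁻ p, ∫⁻ y, ENNReal.ofReal (C₁ * k p y) * φ p y ∂pairMeasure =
      ENNReal.ofReal C₁ * ∫⁻ p, ∫⁻ y, ENNReal.ofReal (k p y) * φ p y ∂pairMeasure := by
  simp only [ENNReal.ofReal_mul hC.le, mul_assoc]
  rw [← lintegral_const_mul' _ _ ENNReal.ofReal_ne_top]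
  exact lintegral_congr fun p => lintegral_const_mul' _ _ ENNReal.ofReal_ne_top

theorem isBilinearKernel_gain {C₁ b ε : ℝ} (hC : 0 < C₁) (hb : 0 < b) (hε : 0 < ε) :
    IsBilinearKernel (volume : Measure Mom) pairMeasure (fun x => C₁ * cutKernel b ε x.1 x.2.1)
      (fun x => outP x.1 x.2.1 (x.2.2 : Mom)) (fun x => outQ x.1 x.2.1 (x.2.2 : Mom))
      (rateBound C₁ b ε) where
  measurable_kernel := by fun_prop
  kernel_nonneg x := mul_nonneg hC.le (cutKernel_nonneg _ _ _ _)
  measurable_left := by fun_prop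
  measurable_right := by fun_prop
  bound_nonneg := (rateBound_pos hC hε).le
  bound F G hF hG := by
    have h := lintegral_gain b hε hF hG (W := fun _ => 1) measurable_const
    simp only [one_mul] at h
    rw [lintegral_ofReal_const_mul_left hC, h]
    exact lintegral_cutKernel_mul_le hC hb hε hF hG

theorem isBilinearKernel_loss {C₁ b ε : ℝ} (hC : 0 < C₁) (hb : 0 < b) (hε : 0 < ε) :
    IsBilinearKernel (volume : Measure Mom) pairMeasure (fun x => C₁ * cutKernel b ε x.1 x.2.1)
      (fun x => x.1) (fun x => x.2.1) (rateBound C₁ b ε) where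
  measurable_kernel := by fun_prop
  kernel_nonneg x := mul_nonneg hC.le (cutKernel_nonneg _ _ _ _)
  measurable_left := by fun_prop
  measurable_right := by fun_prop
  bound_nonneg := (rateBound_pos hC hε).le
  bound F G hF hG := by
    have h := lintegral_loss b ε hG F fun _ => 1
    simp only [one_mul] at h
    rw [lintegral_ofReal_const_mul_left hC, h]
    exact lintegral_cutKernel_mul_le hC hb hε hF hG

/-- The collision integrand is integrable and the collision operator is the difference of the gain
and the loss operator. -/
theorem collision_ae {C₁ b ε : ℝ} (hC : 0 < C₁) (hb : 0 < b) (hε : 0 < ε) (f : L1) :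
    (∀ᵐ p, Integrable (collisionIntegrand b ε f p) pairMeasure) ∧
    (((isBilinearKernel_gain hC hb hε).clm f f - (isBilinearKernel_loss hC hb hε).clm f f : L1) :
      Mom → ℝ) =ᵐ[volume] collisionOp C₁ b ε f := by
  set hg := isBilinearKernel_gain hC hb hε
  set hl := isBilinearKernel_loss hC hb hε
  have key : ∀ᵐ p, Integrable (fun y : Mom × S2 => C₁ * collisionIntegrand b ε f p y)
      pairMeasure ∧ (hg.clm f f - hl.clm f f : L1) p = collisionOp C₁ b ε f p := by
    filter_upwards [hg.coeFn_toL1 f f, hl.coeFn_toL1 f f, Lp.coeFn_sub (hg.clm f f) (hl.clm f f),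
      (hg.integrable_L1 f f).prod_right_ae, (hl.integrable_L1 f f).prod_right_ae]
      with p h1 h2 h3 h4 h5
    have e : (fun y : Mom × S2 => C₁ * collisionIntegrand b ε f p y) = fun y =>
        C₁ * cutKernel b ε p y.1 * (f (outP p y.1 (y.2 : Mom)) * f (outQ p y.1 (y.2 : Mom))) -
        C₁ * cutKernel b ε p y.1 * (f p * f y.1) := by
      ext y; rw [collisionIntegrand]; ring
    refine ⟨e ▸ h4.sub h5, ?_⟩
    rw [h3, Pi.sub_apply, IsBilinearKernel.clm_apply, IsBilinearKernel.clm_apply, h1, h2,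
      collisionOp, ← integral_const_mul, e, integral_sub h4 h5]
  refine ⟨?_, key.mono fun p hp => hp.2⟩
  filter_upwards [key] with p hp
  exact (integrable_const_mul_iff (IsUnit.mk0 _ hC.ne') _).1 hp.1

theorem integral_eq_norm_of_nonneg {f : L1} (hf : 0 ≤ f) : L1.integralCLM (μ := volume) f = ‖f‖ := by
  rw [← L1.integral_eq, L1.integral_eq_integral, L1.norm_eq_integral_norm]
  refine integral_congr_ae ?_
  filter_upwards [(Lp.coeFn_nonneg f).2 hf] with x hx
  exact (Real.norm_of_nonneg hx).symm

theorem ofReal_norm_of_nonneg {f : L1} (hf : 0 ≤ f) :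
    ENNReal.ofReal ‖f‖ = ∫⁻ p, ENNReal.ofReal (f p) := by
  rw [ofReal_norm, Lp.enorm_def, eLpNorm_one_eq_lintegral_enorm]
  refine lintegral_congr_ae ?_
  filter_upwards [(Lp.coeFn_nonneg f).2 hf] with x hx
  exact Real.enorm_of_nonneg hx

theorem lintegral_mul_gain {C₁ b ε : ℝ} (hC : 0 < C₁) (hb : 0 < b) (hε : 0 < ε) {f g : L1}
    (hf : 0 ≤ f) (hg : 0 ≤ g) {W : Mom → ENNReal} (hW : Measurable W) :
    ∫⁻ p, W p * ENNReal.ofReal ((isBilinearKernel_gain hC hb hε).clm f g p) =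
      ENNReal.ofReal C₁ * ∫⁻ p, ∫⁻ q, ENNReal.ofReal (cutKernel b ε p q) *
      ((ENNReal.ofReal (f p) * ENNReal.ofReal (g q)) *
        ∫⁻ w, W (outP p q (w : Mom)) ∂sphereMeasure) := by
  have hfm := (Lp.stronglyMeasurable f).measurable.ennreal_ofReal
  have hgm := (Lp.stronglyMeasurable g).measurable.ennreal_ofReal
  rw [(isBilinearKernel_gain hC hb hε).lintegral_mul_clm hf hg W,
    lintegral_ofReal_const_mul_left hC, lintegral_gain b hε hfm hgm hW]

theorem lintegral_mul_loss {C₁ b ε : ℝ} (hC : 0 < C₁) (hb : 0 < b) (hε : 0 < ε) {f g : L1}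
    (hf : 0 ≤ f) (hg : 0 ≤ g) (W : Mom → ENNReal) :
    ∫⁻ p, W p * ENNReal.ofReal ((isBilinearKernel_loss hC hb hε).clm f g p) =
      ENNReal.ofReal C₁ * ∫⁻ p, ∫⁻ q, ENNReal.ofReal (cutKernel b ε p q) *
      ((ENNReal.ofReal (f p) * ENNReal.ofReal (g q)) * ∫⁻ _, W p ∂sphereMeasure) := by
  have hgm := (Lp.stronglyMeasurable g).measurable.ennreal_ofReal
  rw [(isBilinearKernel_loss hC hb hε).lintegral_mul_clm hf hg W,
    lintegral_ofReal_const_mul_left hC]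
  exact congrArg _ (lintegral_loss b ε hgm (fun p => ENNReal.ofReal (f p)) W)

/-- Conservation of mass: with the test function `1` the weak forms of gain and loss coincide. -/
theorem norm_gain_eq_norm_loss {C₁ b ε : ℝ} (hC : 0 < C₁) (hb : 0 < b) (hε : 0 < ε) {f g : L1}
    (hf : 0 ≤ f) (hg : 0 ≤ g) :
    ‖(isBilinearKernel_gain hC hb hε).clm f g‖ = ‖(isBilinearKernel_loss hC hb hε).clm f g‖ := by
  have h1 := lintegral_mul_gain hC hb hε hf hg (W := fun _ => 1) measurable_const
  have h2 := lintegral_mul_loss hC hb hε hf hg fun _ => 1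
  rw [← h2] at h1
  simp only [one_mul] at h1
  rw [← ofReal_norm_of_nonneg ((isBilinearKernel_gain hC hb hε).clm_nonneg hf hg),
    ← ofReal_norm_of_nonneg ((isBilinearKernel_loss hC hb hε).clm_nonneg hf hg)] at h1
  exact (ENNReal.ofReal_eq_ofReal_iff (norm_nonneg _) (norm_nonneg _)).1 h1

/-! ### The positivity-preserving shifted operator. -/

/-- The collision operator plus a multiple of the total mass, as a bilinear operator: it preserves
the cone of nonnegative functions. -/
def shifted {C₁ b ε : ℝ} (hC : 0 < C₁) (hb : 0 < b) (hε : 0 < ε) : L1 →L[ℝ] L1 →L[ℝ] L1 :=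
  (isBilinearKernel_gain hC hb hε).clm - (isBilinearKernel_loss hC hb hε).clm +
    rateBound C₁ b ε • ContinuousLinearMap.smulRightL ℝ L1 L1 (L1.integralCLM (μ := volume))

theorem shifted_apply {C₁ b ε : ℝ} (hC : 0 < C₁) (hb : 0 < b) (hε : 0 < ε) (f g : L1) :
    shifted hC hb hε f g = (isBilinearKernel_gain hC hb hε).clm f g -
      (isBilinearKernel_loss hC hb hε).clm f g +
      rateBound C₁ b ε • (L1.integralCLM (μ := volume) g • f) := rfl

theorem loss_le {C₁ b ε : ℝ} (hC : 0 < C₁) (hb : 0 < b) (hε : 0 < ε) {f g : L1}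
    (hf : 0 ≤ f) (hg : 0 ≤ g) : (isBilinearKernel_loss hC hb hε).clm f g ≤
      rateBound C₁ b ε • (L1.integralCLM (μ := volume) g • f) := by
  have hg0 : ∀ᵐ x, max (g x) 0 = g x := by
    filter_upwards [(Lp.coeFn_nonneg g).2 hg] with x hx
    exact max_eq_left hx
  set hl := isBilinearKernel_loss hC hb hε
  have hint := (hl.integrable_L1 f g).congr (hl.integrand_congr (ae_eq_refl _) (ae_eq_symm hg0))
  rw [← Lp.coeFn_le]
  filter_upwards [hl.coeFn_toL1_of_ae_eq f g (ae_eq_refl _) (ae_eq_symm hg0),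
    hint.prod_right_ae, (Lp.coeFn_nonneg f).2 hf,
    Lp.coeFn_smul (rateBound C₁ b ε) (L1.integralCLM (μ := volume) g • f),
    Lp.coeFn_smul (L1.integralCLM (μ := volume) g) f] with p h1 h2 h3 h4 h5
  have hfp : 0 ≤ f p := h3
  rw [IsBilinearKernel.clm_apply, h1, h4, Pi.smul_apply, h5, Pi.smul_apply, smul_eq_mul,
    smul_eq_mul]
  have hgi : Integrable (fun q => max (g q) 0) := (L1.integrable_coeFn g).congr (ae_eq_symm hg0)
  have hgI : ∫ q, max (g q) 0 = L1.integralCLM (μ := volume) g := by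
    rw [← L1.integral_eq, L1.integral_eq_integral]; exact integral_congr_ae hg0
  have hyI : Integrable (fun y : Mom × S2 => max (g y.1) 0) pairMeasure := hgi.comp_fst _
  calc _ ≤ ∫ y : Mom × S2, C₁ * (4 * ε ^ (-b)) * f p * max (g y.1) 0 ∂pairMeasure := by
        refine integral_mono h2 (hyI.const_mul _) fun y => ?_
        have := cutKernel_le hb hε p y.1
        have : 0 ≤ max (g y.1) 0 := le_max_right _ _
        simp only
        rw [← mul_assoc]
        gcongr
    _ = _ := by
        rw [integral_const_mul, integral_fun_fst (fun q => max (g q) 0), hgI, rateBound,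
          smul_eq_mul]
        ring

theorem shifted_nonneg {C₁ b ε : ℝ} (hC : 0 < C₁) (hb : 0 < b) (hε : 0 < ε) {f g : L1}
    (hf : 0 ≤ f) (hg : 0 ≤ g) : 0 ≤ shifted hC hb hε f g := by
  rw [shifted_apply, sub_add_eq_add_sub, add_sub_assoc]
  exact add_nonneg ((isBilinearKernel_gain hC hb hε).clm_nonneg hf hg)
    (sub_nonneg.2 (loss_le hC hb hε hf hg))

/-- On the cone the norm is the integral, which is linear. Gain and loss cancel in it, and only the
added term remains. -/
theorem norm_shifted {C₁ b ε : ℝ} (hC : 0 < C₁) (hb : 0 < b) (hε : 0 < ε) {f g : L1}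
    (hf : 0 ≤ f) (hg : 0 ≤ g) :
    ‖shifted hC hb hε f g‖ = rateBound C₁ b ε * (‖f‖ * ‖g‖) := by
  rw [← integral_eq_norm_of_nonneg (shifted_nonneg hC hb hε hf hg), shifted_apply, map_add, map_sub,
    integral_eq_norm_of_nonneg ((isBilinearKernel_gain hC hb hε).clm_nonneg hf hg),
    integral_eq_norm_of_nonneg ((isBilinearKernel_loss hC hb hε).clm_nonneg hf hg),
    norm_gain_eq_norm_loss hC hb hε hf hg, sub_self, zero_add, map_smul, map_smul,
    integral_eq_norm_of_nonneg hf, integral_eq_norm_of_nonneg hg, smul_eq_mul, smul_eq_mul,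
    mul_comm ‖f‖]

/-! ### The Wild sum for an abstract bilinear equation. -/

section WildSum

variable {E : Type*} [NormedAddCommGroup E] [NormedSpace ℝ E]

/-- The coefficients of the Wild sum. -/
def wildCoeff (Γ : E →L[ℝ] E →L[ℝ] E) (l : ℝ) (x : E) : ℕ → E
  | 0 => x
  | n + 1 => (l * (n + 1))⁻¹ • ∑ i : Fin (n + 1),
      Γ (wildCoeff Γ l x i) (wildCoeff Γ l x (n - i))
decreasing_by all_goals omega

theorem wildCoeff_zero (Γ : E →L[ℝ] E →L[ℝ] E) (l : ℝ) (x : E) : wildCoeff Γ l x 0 = x := by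
  rw [wildCoeff]

theorem wildCoeff_succ (Γ : E →L[ℝ] E →L[ℝ] E) (l : ℝ) (x : E) (n : ℕ) :
    wildCoeff Γ l x (n + 1) = (l * (n + 1))⁻¹ • ∑ ij ∈ Finset.HasAntidiagonal.antidiagonal n,
      Γ (wildCoeff Γ l x ij.1) (wildCoeff Γ l x ij.2) := by
  rw [wildCoeff, Finset.Nat.sum_antidiagonal_eq_sum_range_succ
    (fun i j => Γ (wildCoeff Γ l x i) (wildCoeff Γ l x j)), Finset.sum_range]

/-- A property which passes from the factors to `Γ` and is stable under sums and nonnegative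
multiples holds for all Wild coefficients. -/
theorem wildCoeff_mem {Γ : E →L[ℝ] E →L[ℝ] E} {l : ℝ} (hl : 0 < l) {x : E} {K : Set E}
    (hx : x ∈ K) (h0 : 0 ∈ K) (hadd : ∀ y ∈ K, ∀ z ∈ K, y + z ∈ K)
    (hsmul : ∀ r : ℝ, 0 ≤ r → ∀ y ∈ K, r • y ∈ K) (hΓ : ∀ y ∈ K, ∀ z ∈ K, Γ y z ∈ K) (n : ℕ) :
    wildCoeff Γ l x n ∈ K := by
  induction n using Nat.strong_induction_on with
  | _ n ih =>
    cases n with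
    | zero => rwa [wildCoeff_zero]
    | succ n =>
      rw [wildCoeff_succ]
      refine hsmul _ (by positivity) _ ?_
      refine Finset.sum_induction _ (· ∈ K) (fun y z hy hz => hadd y hy z hz) h0 fun ij hij => ?_
      have := Finset.HasAntidiagonal.mem_antidiagonal.1 hij
      exact hΓ _ (ih _ (by omega)) _ (ih _ (by omega))

/-- With `l = c * ‖x‖` the `n + 1` terms of the convolution exactly cancel the normalisation `l * (n
+ 1)`, so the coefficients stay bounded. The series then converges for all `s ≥ 0`, since `1 - exp
(-(l * s)) < 1`. -/
theorem norm_wildCoeff_le {Γ : E →L[ℝ] E →L[ℝ] E} {c : ℝ} (hc : 0 < c) {x : E} (hx : x ≠ 0)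
    {K : Set E} (hK : ∀ n, wildCoeff Γ (c * ‖x‖) x n ∈ K)
    (hΓ : ∀ y ∈ K, ∀ z ∈ K, ‖Γ y z‖ ≤ c * (‖y‖ * ‖z‖)) (n : ℕ) :
    ‖wildCoeff Γ (c * ‖x‖) x n‖ ≤ ‖x‖ := by
  have hM : 0 < ‖x‖ := norm_pos_iff.2 hx
  induction n using Nat.strong_induction_on with
  | _ n ih =>
    cases n with
    | zero => rw [wildCoeff_zero]
    | succ n =>
      rw [wildCoeff_succ, norm_smul, Real.norm_of_nonneg (by positivity)]
      have : ‖∑ ij ∈ Finset.HasAntidiagonal.antidiagonal n, Γ (wildCoeff Γ (c * ‖x‖) x ij.1)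
          (wildCoeff Γ (c * ‖x‖) x ij.2)‖ ≤ (n + 1) * (c * (‖x‖ * ‖x‖)) := by
        refine (norm_sum_le_of_le (f := fun ij : ℕ × ℕ => Γ (wildCoeff Γ (c * ‖x‖) x ij.1)
          (wildCoeff Γ (c * ‖x‖) x ij.2)) (n := fun _ => c * (‖x‖ * ‖x‖)) _ fun ij hij => ?_).trans ?_
        · have := Finset.HasAntidiagonal.mem_antidiagonal.1 hij
          refine (hΓ _ (hK _) _ (hK _)).trans ?_
          have h1 := ih ij.1 (by omega)
          have h2 := ih ij.2 (by omega)
          gcongr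
        · simp
      calc _ ≤ (c * ‖x‖ * (n + 1))⁻¹ * ((n + 1) * (c * (‖x‖ * ‖x‖))) := by gcongr
        _ = ‖x‖ := by field_simp

theorem summable_norm_powerSeries {a : ℕ → E} {M : ℝ} (ha : ∀ n, ‖a n‖ ≤ M) {u : ℝ} (hu : |u| < 1) :
    Summable fun n => ‖u ^ n • a n‖ := by
  refine Summable.of_nonneg_of_le (fun n => norm_nonneg _) (fun n => ?_)
    ((summable_geometric_of_lt_one (abs_nonneg u) hu).mul_right M)
  rw [norm_smul, norm_pow, Real.norm_eq_abs]
  have := ha n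
  gcongr

/-- The Wild sum. -/
def wildSum (Γ : E →L[ℝ] E →L[ℝ] E) (l : ℝ) (x : E) (s : ℝ) : E :=
  Real.exp (-(l * s)) • ∑' n, (1 - Real.exp (-(l * s))) ^ n • wildCoeff Γ l x n

theorem wildSum_zero (Γ : E →L[ℝ] E →L[ℝ] E) (l : ℝ) (x : E) : wildSum Γ l x 0 = x := by
  rw [wildSum, tsum_eq_single 0 fun n hn => by simp [hn]]
  simp [wildCoeff_zero]

theorem abs_one_sub_exp_lt {l s : ℝ} (hl : 0 < l) (hs : 0 ≤ s) :
    |1 - Real.exp (-(l * s))| < 1 := by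
  have h1 := Real.exp_pos (-(l * s))
  have h2 : Real.exp (-(l * s)) ≤ 1 := Real.exp_le_one_iff.2 (by nlinarith)
  rw [abs_lt]; constructor <;> linarith

theorem apply_wildCoeff {Γ : E →L[ℝ] E →L[ℝ] E} {c : ℝ} (hc : 0 < c) {x : E} {I : E →L[ℝ] ℝ}
    (hx : 0 < I x) {K : Set E} (hK : ∀ n, wildCoeff Γ (c * I x) x n ∈ K)
    (hΓ : ∀ y ∈ K, ∀ z ∈ K, I (Γ y z) = c * (I y * I z)) (n : ℕ) :
    I (wildCoeff Γ (c * I x) x n) = I x := by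
  induction n using Nat.strong_induction_on with
  | _ n ih =>
    cases n with
    | zero => rw [wildCoeff_zero]
    | succ n =>
      rw [wildCoeff_succ, map_smul, map_sum, Finset.sum_congr rfl (g := fun _ => c * (I x * I x))]
      · simp only [Finset.sum_const, Finset.Nat.card_antidiagonal, nsmul_eq_mul, smul_eq_mul]
        push_cast
        field_simp
      · intro ij hij
        have := Finset.HasAntidiagonal.mem_antidiagonal.1 hij
        rw [hΓ _ (hK _) _ (hK _), ih _ (by omega), ih _ (by omega)]

variable [CompleteSpace E]

/-- The Cauchy product, with `Γ` in place of multiplication. -/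
theorem tsum_bilinear_antidiagonal (Γ : E →L[ℝ] E →L[ℝ] E) {a : ℕ → E}
    (ha : Summable fun n => ‖a n‖) :
    Γ (∑' n, a n) (∑' n, a n) = ∑' n, ∑ ij ∈ Finset.HasAntidiagonal.antidiagonal n, Γ (a ij.1) (a ij.2) := by
  have hs : Summable fun x : ℕ × ℕ => Γ (a x.1) (a x.2) := by
    refine Summable.of_norm_bounded (g := fun x : ℕ × ℕ => ‖Γ‖ * (‖a x.1‖ * ‖a x.2‖))
      ((ha.mul_of_nonneg ha (fun _ => norm_nonneg _) fun _ => norm_nonneg _).mul_left _) fun x => ?_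
    rw [← mul_assoc]
    exact Γ.le_opNorm₂ _ _
  have ha' := ha.of_norm
  calc Γ (∑' n, a n) (∑' n, a n) = ∑' i, ∑' j, Γ (a i) (a j) := by
        rw [Γ.map_tsum ha', ← ContinuousLinearMap.apply_apply (∑' n, a n),
          ContinuousLinearMap.map_tsum _ (ha'.mapL Γ)]
        refine tsum_congr fun i => ?_
        rw [ContinuousLinearMap.apply_apply, ContinuousLinearMap.map_tsum _ ha']
    _ = ∑' x : ℕ × ℕ, Γ (a x.1) (a x.2) := hs.tsum_prod.symm
    _ = _ := by
      rw [← Finset.HasAntidiagonal.sigmaAntidiagonalEquivProd.tsum_eq]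
      have hs' := Finset.HasAntidiagonal.sigmaAntidiagonalEquivProd.summable_iff.2 hs
      refine (Summable.tsum_sigma hs').trans (tsum_congr fun n => ?_)
      rw [tsum_fintype]
      exact Finset.sum_coe_sort (Finset.HasAntidiagonal.antidiagonal n) fun ij => Γ (a ij.1) (a ij.2)

theorem hasDerivAt_powerSeries {a : ℕ → E} {M : ℝ} (ha : ∀ n, ‖a n‖ ≤ M) {u : ℝ} (hu : |u| < 1) :
    HasDerivAt (fun u : ℝ => ∑' n, u ^ n • a n) (∑' n : ℕ, u ^ n • ((n + 1 : ℝ) • a (n + 1))) u := by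
  obtain ⟨r, hur, hr1⟩ := exists_between hu
  have hr0 : 0 ≤ r := (abs_nonneg u).trans hur.le
  have hsum : Summable fun n : ℕ => (n : ℝ) * r ^ (n - 1) * M := by
    refine Summable.mul_right _ ?_
    rw [← summable_nat_add_iff 1]
    have h1 := summable_pow_mul_geometric_of_norm_lt_one 1 (r := r) (by
      rwa [Real.norm_of_nonneg hr0])
    have h2 := summable_geometric_of_lt_one hr0 hr1
    refine (h1.add h2).congr fun n => ?_
    simp only [Nat.cast_add, Nat.cast_one, Nat.add_sub_cancel]
    ring
  have key := hasDerivAt_tsum_of_isPreconnected (g := fun (n : ℕ) (u : ℝ) => u ^ n • a n)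
    (g' := fun (n : ℕ) (u : ℝ) => ((n : ℝ) * u ^ (n - 1)) • a n) (t := Metric.ball 0 r) (y₀ := 0)
    (y := u) hsum Metric.isOpen_ball (convex_ball _ _).isPreconnected
    (fun n y _ => (hasDerivAt_pow n y).smul_const (a n)) (fun n y hy => ?_) ?_ ?_ (by simpa using hur)
  · refine key.congr_deriv ?_
    have hs : Summable fun n : ℕ => ((n : ℝ) * u ^ (n - 1)) • a n := by
      refine Summable.of_norm_bounded hsum fun n => ?_
      rw [norm_smul, norm_mul, norm_pow, Real.norm_natCast, Real.norm_eq_abs]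
      have := ha n
      gcongr
    rw [hs.tsum_eq_zero_add]
    simp only [Nat.cast_zero, zero_mul, zero_smul, zero_add]
    refine tsum_congr fun n => ?_
    rw [smul_smul, Nat.add_sub_cancel, mul_comm]
    push_cast
    rfl
  · rw [norm_smul, norm_mul, norm_pow, Real.norm_natCast, Real.norm_eq_abs]
    have h1 : |y| < r := by simpa using hy
    have := ha n
    gcongr
  · exact Metric.mem_ball_self ((abs_nonneg u).trans_lt hur)
  · refine summable_of_ne_finset_zero (s := {0}) fun n hn => ?_
    rw [zero_pow (by simpa using hn), zero_smul]

theorem hasDerivAt_wildSum {Γ : E →L[ℝ] E →L[ℝ] E} {l : ℝ} (hl : 0 < l) {x : E} {M : ℝ}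
    (hM : ∀ n, ‖wildCoeff Γ l x n‖ ≤ M) {s : ℝ} (hs : 0 ≤ s) :
    HasDerivAt (wildSum Γ l x)
      (Γ (wildSum Γ l x s) (wildSum Γ l x s) - l • wildSum Γ l x s) s := by
  have hu := abs_one_sub_exp_lt hl hs
  have hexp : HasDerivAt (fun s : ℝ => Real.exp (-(l * s))) (-(l * Real.exp (-(l * s)))) s := by
    have := (((hasDerivAt_id' s).const_mul l).neg).exp
    refine this.congr_deriv ?_
    simp only [Pi.neg_apply]; ring
  have hps := hasDerivAt_powerSeries hM hu
  have hcomp := hps.scomp s (hexp.const_sub 1)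
  have hprod := hexp.smul hcomp
  refine hprod.congr_deriv ?_
  -- The recursion says that the power series `S(u)` of the coefficients satisfies `S' = l⁻¹ Γ(S,
  -- S)`.
  have hsum : (∑' n : ℕ, (1 - Real.exp (-(l * s))) ^ n • ((n + 1 : ℝ) • wildCoeff Γ l x (n + 1))) =
      l⁻¹ • Γ (∑' n, (1 - Real.exp (-(l * s))) ^ n • wildCoeff Γ l x n)
        (∑' n, (1 - Real.exp (-(l * s))) ^ n • wildCoeff Γ l x n) := by
    rw [tsum_bilinear_antidiagonal Γ (summable_norm_powerSeries hM hu), ← tsum_const_smul'']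
    refine tsum_congr fun n => ?_
    rw [wildCoeff_succ, smul_smul, Finset.smul_sum, Finset.smul_sum, Finset.smul_sum]
    refine Finset.sum_congr rfl fun ij hij => ?_
    rw [map_smul, map_smul, _root_.smul_apply, smul_smul, smul_smul, smul_smul,
      ← Finset.HasAntidiagonal.mem_antidiagonal.1 hij, pow_add,
      Finset.HasAntidiagonal.mem_antidiagonal.1 hij]
    congr 1
    field_simp
  simp only [Function.comp_def]
  rw [hsum, wildSum, map_smul, map_smul, _root_.smul_apply]
  simp only [smul_smul]
  rw [show Real.exp (-(l * s)) * (- -(l * Real.exp (-(l * s))) * l⁻¹) =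
    Real.exp (-(l * s)) * Real.exp (-(l * s)) by field_simp]
  module

theorem wildSum_mem {Γ : E →L[ℝ] E →L[ℝ] E} {l : ℝ} (hl : 0 < l) {x : E} {M : ℝ}
    (hM : ∀ n, ‖wildCoeff Γ l x n‖ ≤ M) {K : Set E} (hK : IsClosed K)
    (h0 : 0 ∈ K) (hadd : ∀ y ∈ K, ∀ z ∈ K, y + z ∈ K)
    (hsmul : ∀ r : ℝ, 0 ≤ r → ∀ y ∈ K, r • y ∈ K) (hmem : ∀ n, wildCoeff Γ l x n ∈ K)
    {s : ℝ} (hs : 0 ≤ s) : wildSum Γ l x s ∈ K := by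
  have hu := abs_one_sub_exp_lt hl hs
  have h1 : 0 ≤ 1 - Real.exp (-(l * s)) := by
    have : Real.exp (-(l * s)) ≤ 1 := Real.exp_le_one_iff.2 (by nlinarith)
    linarith
  refine hsmul _ (Real.exp_pos _).le _ ?_
  refine hK.mem_of_tendsto (summable_norm_powerSeries hM hu).of_norm.hasSum
    (Filter.Eventually.of_forall fun S => ?_)
  exact Finset.sum_induction _ (· ∈ K) (fun y z hy hz => hadd y hy z hz) h0
    fun n _ => hsmul _ (by positivity) _ (hmem n)

theorem apply_wildSum {Γ : E →L[ℝ] E →L[ℝ] E} {l : ℝ} (hl : 0 < l) {x : E} {M : ℝ}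
    (hM : ∀ n, ‖wildCoeff Γ l x n‖ ≤ M) {I : E →L[ℝ] ℝ} (hI : ∀ n, I (wildCoeff Γ l x n) = I x)
    {s : ℝ} (hs : 0 ≤ s) : I (wildSum Γ l x s) = I x := by
  have hu := abs_one_sub_exp_lt hl hs
  rw [wildSum, map_smul, I.map_tsum (summable_norm_powerSeries hM hu).of_norm]
  simp only [map_smul, hI, smul_eq_mul]
  rw [tsum_mul_right, tsum_geometric_of_abs_lt_one hu, sub_sub_cancel, ← mul_assoc,
    mul_inv_cancel₀ (Real.exp_ne_zero _), one_mul]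

end WildSum

theorem lipschitzOnWith_bilinear {E : Type*} [NormedAddCommGroup E] [NormedSpace ℝ E]
    (B : E →L[ℝ] E →L[ℝ] E) (R : NNReal) :
    LipschitzOnWith (‖B‖₊ * (2 * R)) (fun f => B f f) (Metric.closedBall 0 R) := by
  refine LipschitzOnWith.of_dist_le_mul fun f hf g hg => ?_
  have hf' : ‖f‖ ≤ R := by simpa using hf
  have hg' : ‖g‖ ≤ R := by simpa using hg
  rw [dist_eq_norm, dist_eq_norm]
  have e : B f f - B g g = B f (f - g) + B (f - g) g := by
    simp only [map_sub, _root_.sub_apply]; abel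
  rw [e]
  push_cast
  calc ‖B f (f - g) + B (f - g) g‖ ≤ ‖B‖ * ‖f‖ * ‖f - g‖ + ‖B‖ * ‖f - g‖ * ‖g‖ :=
        (norm_add_le _ _).trans (add_le_add (B.le_opNorm₂ _ _) (B.le_opNorm₂ _ _))
    _ ≤ ‖B‖ * R * ‖f - g‖ + ‖B‖ * ‖f - g‖ * R := by gcongr
    _ = _ := by ring

/-! ### Isotropic functions and invariance under isometries. -/

section Isotropy

/-- Isotropy as measurability for the σ-algebra generated by the norm; in this form it is known to
be closed in `L¹`. -/
theorem isIsotropic_iff {f : L1} : IsIsotropic f ↔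
    AEStronglyMeasurable[MeasurableSpace.comap (fun p : Mom => ‖p‖) inferInstance] f volume := by
  constructor
  · rintro ⟨g, hg, h⟩
    exact ⟨fun p => g ‖p‖, (hg.comp (comap_measurable _)).stronglyMeasurable, h⟩
  · rintro ⟨v, hv, h⟩
    obtain ⟨g, hg, rfl⟩ := hv.exists_eq_measurable_comp
    exact ⟨g, hg.measurable, h⟩

theorem isClosed_isIsotropic : IsClosed {f : L1 | IsIsotropic f} := by
  simp only [isIsotropic_iff]
  exact isClosed_aestronglyMeasurable measurable_norm.comap_le

theorem IsIsotropic.add {f g : L1} (hf : IsIsotropic f) (hg : IsIsotropic g) :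
    IsIsotropic (f + g) := by
  obtain ⟨u, hu, hfu⟩ := hf
  obtain ⟨v, hv, hgv⟩ := hg
  refine ⟨fun r => u r + v r, hu.add hv, ?_⟩
  filter_upwards [Lp.coeFn_add f g, hfu, hgv] with p h1 h2 h3
  rw [h1, Pi.add_apply, h2, h3]

theorem IsIsotropic.smul (r : ℝ) {f : L1} (hf : IsIsotropic f) : IsIsotropic (r • f) := by
  obtain ⟨u, hu, hfu⟩ := hf
  refine ⟨fun t => r * u t, hu.const_mul r, ?_⟩
  filter_upwards [Lp.coeFn_smul r f, hfu] with p h1 h2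
  rw [h1, Pi.smul_apply, h2, smul_eq_mul]

theorem isIsotropic_zero : IsIsotropic 0 :=
  ⟨fun _ => 0, measurable_const, Lp.coeFn_zero _ _ _⟩

/-- The action of a linear isometry on the unit sphere. -/
def sphereMap (ρ : Mom ≃ₗᵢ[ℝ] Mom) (w : S2) : S2 :=
  ⟨ρ w, by simp⟩

theorem measurable_sphereMap (ρ : Mom ≃ₗᵢ[ℝ] Mom) : Measurable (sphereMap ρ) :=
  (ρ.continuous.measurable.comp measurable_subtype_coe).subtype_mk

open scoped Pointwise in
theorem measurePreserving_sphereMap (ρ : Mom ≃ₗᵢ[ℝ] Mom) :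
    MeasurePreserving (sphereMap ρ) sphereMeasure sphereMeasure := by
  refine ⟨measurable_sphereMap ρ, Measure.ext fun s hs => ?_⟩
  rw [Measure.map_apply (measurable_sphereMap ρ) hs,
    Measure.toSphere_apply' _ (measurable_sphereMap ρ hs), Measure.toSphere_apply' _ hs]
  congr 1
  -- The surface measure is defined by the volume of cones, and an isometry maps cones to cones.
  have : (Ioo (0 : ℝ) 1 • (Subtype.val '' (sphereMap ρ ⁻¹' s)) : Set Mom) =
      ρ ⁻¹' (Ioo (0 : ℝ) 1 • (Subtype.val '' s)) := by
    ext x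
    simp only [mem_smul, mem_image, mem_preimage]
    constructor
    · rintro ⟨t, ht, _, ⟨w, hw, rfl⟩, rfl⟩
      exact ⟨t, ht, _, ⟨_, hw, rfl⟩, (map_smul ρ t _).symm⟩
    · rintro ⟨t, ht, _, ⟨w, hw, rfl⟩, hx⟩
      refine ⟨t, ht, ρ.symm w, ⟨sphereMap ρ.symm w, ?_, rfl⟩, ?_⟩
      · have : sphereMap ρ (sphereMap ρ.symm w) = w := Subtype.ext (ρ.apply_symm_apply w)
        rwa [this]
      · rw [← map_smul, hx, ρ.symm_apply_apply]
  rw [this]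
  exact ρ.measurePreserving.measure_preimage_equiv (f := ρ.toMeasurableEquiv) _

theorem exists_isometry_apply_eq {p q : Mom} (h : ‖p‖ = ‖q‖) : ∃ ρ : Mom ≃ₗᵢ[ℝ] Mom, ρ p = q :=
  ⟨_, Submodule.reflection_sub h⟩

/-- A unit vector. -/
def unitVec : Mom := EuclideanSpace.single 0 1

theorem norm_unitVec : ‖unitVec‖ = 1 := by simp [unitVec]

/-- The action of a linear isometry on the integration variables of the collision operator. -/
def pairMap (ρ : Mom ≃ₗᵢ[ℝ] Mom) (y : Mom × S2) : Mom × S2 := (ρ y.1, sphereMap ρ y.2)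

theorem measurePreserving_pairMap (ρ : Mom ≃ₗᵢ[ℝ] Mom) :
    MeasurePreserving (pairMap ρ) pairMeasure pairMeasure :=
  ρ.measurePreserving.prod (measurePreserving_sphereMap ρ)

theorem isIsotropic_clm {κ : Mom × (Mom × S2) → ℝ} {a c : Mom × (Mom × S2) → Mom} {C : ℝ}
    (h : IsBilinearKernel volume pairMeasure κ a c C)
    (hκ : ∀ (ρ : Mom ≃ₗᵢ[ℝ] Mom) p y, κ (ρ p, pairMap ρ y) = κ (p, y))
    (ha : ∀ (ρ : Mom ≃ₗᵢ[ℝ] Mom) p y, ‖a (ρ p, pairMap ρ y)‖ = ‖a (p, y)‖)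
    (hc : ∀ (ρ : Mom ≃ₗᵢ[ℝ] Mom) p y, ‖c (ρ p, pairMap ρ y)‖ = ‖c (p, y)‖)
    {f g : L1} (hf : IsIsotropic f) (hg : IsIsotropic g) : IsIsotropic (h.clm f g) := by
  obtain ⟨u, hu, hfu⟩ := hf
  obtain ⟨v, hv, hgv⟩ := hg
  have hm : Measurable fun x => κ x * (u ‖a x‖ * v ‖c x‖) :=
    h.measurable_integrand (hu.comp measurable_norm) (hv.comp measurable_norm)
  let I : Mom → ℝ := fun p => ∫ y, κ (p, y) * (u ‖a (p, y)‖ * v ‖c (p, y)‖) ∂pairMeasure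
  have hI : Measurable I := (hm.stronglyMeasurable.integral_prod_right' (ν := pairMeasure)).measurable
  have hinv : ∀ (ρ : Mom ≃ₗᵢ[ℝ] Mom) p, I (ρ p) = I p := by
    intro ρ p
    have hmp := measurePreserving_pairMap ρ
    have hmm : Measurable fun y => κ (ρ p, y) * (u ‖a (ρ p, y)‖ * v ‖c (ρ p, y)‖) :=
      hm.comp measurable_prodMk_left
    calc I (ρ p) = ∫ y, κ (ρ p, y) * (u ‖a (ρ p, y)‖ * v ‖c (ρ p, y)‖)
          ∂(pairMeasure.map (pairMap ρ)) := by rw [hmp.map_eq]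
      _ = I p := by
        rw [integral_map hmp.measurable.aemeasurable hmm.aestronglyMeasurable]
        simp only [hκ, ha, hc, I]
  -- `I` is invariant under all isometries, hence determined by its values on one ray.
  refine ⟨fun r => I (r • unitVec), hI.comp (by fun_prop), ?_⟩
  filter_upwards [h.coeFn_toL1_of_ae_eq f g hfu hgv] with p hp
  rw [IsBilinearKernel.clm_apply, hp]
  obtain ⟨ρ, hρ⟩ := exists_isometry_apply_eq (p := p) (q := ‖p‖ • unitVec)
    (by simp [norm_smul, norm_unitVec])
  rw [← hρ, hinv]

theorem rho_map (ρ : Mom ≃ₗᵢ[ℝ] Mom) (p q : Mom) : rho (ρ p) (ρ q) = rho p q := by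
  simp [rho]

theorem outP_map (ρ : Mom ≃ₗᵢ[ℝ] Mom) (p q w : Mom) :
    outP (ρ p) (ρ q) (ρ w) = ρ (outP p q w) := by
  simp only [outP, rho_map, ← map_add, ρ.inner_map_map, ρ.norm_map, ← map_smul]

theorem outQ_map (ρ : Mom ≃ₗᵢ[ℝ] Mom) (p q w : Mom) :
    outQ (ρ p) (ρ q) (ρ w) = ρ (outQ p q w) := by
  rw [outQ, ← map_neg, outP_map, outQ]

theorem cutKernel_map (b ε : ℝ) (ρ : Mom ≃ₗᵢ[ℝ] Mom) (p q : Mom) :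
    cutKernel b ε (ρ p) (ρ q) = cutKernel b ε p q := by
  simp only [cutKernel, rho_map, ρ.norm_map]

theorem IsIsotropic.gain {C₁ b ε : ℝ} (hC : 0 < C₁) (hb : 0 < b) (hε : 0 < ε) {f g : L1}
    (hf : IsIsotropic f) (hg : IsIsotropic g) :
    IsIsotropic ((isBilinearKernel_gain hC hb hε).clm f g) :=
  isIsotropic_clm (isBilinearKernel_gain hC hb hε)
    (fun ρ p y => congrArg (C₁ * ·) (cutKernel_map b ε ρ p y.1))
    (fun ρ p y => (congrArg norm (outP_map ρ p y.1 y.2)).trans (ρ.norm_map _))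
    (fun ρ p y => (congrArg norm (outQ_map ρ p y.1 y.2)).trans (ρ.norm_map _)) hf hg

theorem IsIsotropic.loss {C₁ b ε : ℝ} (hC : 0 < C₁) (hb : 0 < b) (hε : 0 < ε) {f g : L1}
    (hf : IsIsotropic f) (hg : IsIsotropic g) :
    IsIsotropic ((isBilinearKernel_loss hC hb hε).clm f g) :=
  isIsotropic_clm (isBilinearKernel_loss hC hb hε)
    (fun ρ p y => congrArg (C₁ * ·) (cutKernel_map b ε ρ p y.1))
    (fun ρ p _ => ρ.norm_map p) (fun ρ _ y => ρ.norm_map y.1) hf hg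

theorem IsIsotropic.shifted {C₁ b ε : ℝ} (hC : 0 < C₁) (hb : 0 < b) (hε : 0 < ε) {f g : L1}
    (hf : IsIsotropic f) (hg : IsIsotropic g) : IsIsotropic (shifted hC hb hε f g) := by
  rw [shifted_apply, sub_eq_add_neg, ← neg_one_smul ℝ ((isBilinearKernel_loss hC hb hε).clm f g)]
  exact ((hf.gain hC hb hε hg).add ((hf.loss hC hb hε hg).smul _)).add ((hf.smul _).smul _)

end Isotropy

/-! ### Existence and uniqueness for the modified equation. -/

section Existence

/-- The modified collision operator on `L¹`. -/
def collisionL1 {C₁ b ε : ℝ} (hC : 0 < C₁) (hb : 0 < b) (hε : 0 < ε) (f : L1) : L1 :=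
  (isBilinearKernel_gain hC hb hε).clm f f - (isBilinearKernel_loss hC hb hε).clm f f

theorem continuous_collisionL1 {C₁ b ε : ℝ} (hC : 0 < C₁) (hb : 0 < b) (hε : 0 < ε) :
    Continuous (collisionL1 hC hb hε) := by
  unfold collisionL1; fun_prop

/-- Absolute convergence holds for every element of `L¹`, and continuity of the derivative follows
from continuity of the operator. Only the differential equation in `L¹` remains. -/
theorem isModifiedSolution_iff {C₁ b ε : ℝ} (hC : 0 < C₁) (hb : 0 < b) (hε : 0 < ε)
    {f₀ : L1} {f : ℝ → L1} :
    IsModifiedSolution C₁ b ε f₀ f ↔ f 0 = f₀ ∧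
      ∀ s, 0 ≤ s → HasDerivWithinAt f (collisionL1 hC hb hε (f s)) (Ici 0) s := by
  constructor
  · rintro ⟨h0, -, f', -, hf⟩
    refine ⟨h0, fun s hs => ?_⟩
    obtain ⟨h1, h2⟩ := hf s hs
    have : f' s = collisionL1 hC hb hε (f s) :=
      Lp.ext (h2.trans (ae_eq_symm (collision_ae hC hb hε (f s)).2))
    rwa [← this]
  · rintro ⟨h0, h⟩
    refine ⟨h0, fun s _ => (collision_ae hC hb hε (f s)).1,
      fun s => collisionL1 hC hb hε (f s), ?_, fun s hs => ⟨h s hs, (collision_ae hC hb hε (f s)).2⟩⟩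
    exact (continuous_collisionL1 hC hb hε).comp_continuousOn
      fun s hs => (h s hs).continuousWithinAt

theorem IsModifiedSolution.eqOn {C₁ b ε : ℝ} (hC : 0 < C₁) (hb : 0 < b) (hε : 0 < ε)
    {f₀ : L1} {f g : ℝ → L1} (hf : IsModifiedSolution C₁ b ε f₀ f)
    (hg : IsModifiedSolution C₁ b ε f₀ g) : EqOn f g (Ici 0) := by
  obtain ⟨hf0, hf⟩ := (isModifiedSolution_iff hC hb hε).1 hf
  obtain ⟨hg0, hg⟩ := (isModifiedSolution_iff hC hb hε).1 hg
  intro t ht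
  have hcf : ContinuousOn f (Icc 0 t) := fun s hs =>
    (hf s hs.1).continuousWithinAt.mono Icc_subset_Ici_self
  have hcg : ContinuousOn g (Icc 0 t) := fun s hs =>
    (hg s hs.1).continuousWithinAt.mono Icc_subset_Ici_self
  obtain ⟨R₁, hR₁⟩ := isCompact_Icc.exists_bound_of_continuousOn hcf
  obtain ⟨R₂, hR₂⟩ := isCompact_Icc.exists_bound_of_continuousOn hcg
  -- Both solutions are bounded on the compact interval, so they stay in a common ball, where the
  -- quadratic field is Lipschitz.
  have hK := lipschitzOnWith_bilinear ((isBilinearKernel_gain hC hb hε).clm -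
    (isBilinearKernel_loss hC hb hε).clm) (max R₁ R₂).toNNReal
  have hmem : ∀ R : ℝ, R ≤ max R₁ R₂ → ∀ x : L1, ‖x‖ ≤ R →
      x ∈ Metric.closedBall (0 : L1) ((max R₁ R₂).toNNReal : ℝ) := fun R hR x hx => by
    rw [mem_closedBall_zero_iff]
    exact (hx.trans hR).trans (Real.le_coe_toNNReal _)
  exact ODE_solution_unique_of_mem_Icc_right (v := fun _ => collisionL1 hC hb hε)
    (s := fun _ => Metric.closedBall 0 ((max R₁ R₂).toNNReal : ℝ)) (fun _ _ => hK) hcf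
    (fun s hs => (hf s hs.1).mono (Ici_subset_Ici.2 hs.1))
    (fun s hs => hmem _ (le_max_left _ _) _ (hR₁ s (Ico_subset_Icc_self hs))) hcg
    (fun s hs => (hg s hs.1).mono (Ici_subset_Ici.2 hs.1))
    (fun s hs => hmem _ (le_max_right _ _) _ (hR₂ s (Ico_subset_Icc_self hs)))
    (hf0.trans hg0.symm) ⟨ht, le_rfl⟩

theorem smul_nonneg_of_nonneg {r : ℝ} (hr : 0 ≤ r) {f : L1} (hf : 0 ≤ f) : 0 ≤ r • f := by
  rw [← Lp.coeFn_nonneg] at hf ⊢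
  filter_upwards [hf, Lp.coeFn_smul r f] with p h1 h2
  rw [h2]
  exact mul_nonneg hr h1

theorem exists_isModifiedSolution {C₁ b ε : ℝ} (hC : 0 < C₁) (hb : 0 < b) (hε : 0 < ε)
    {f₀ : L1} (hf₀ : 0 ≤ f₀) : ∃ f : ℝ → L1,
    IsModifiedSolution C₁ b ε f₀ f ∧ (∀ s, 0 ≤ s → 0 ≤ f s) ∧
    (IsIsotropic f₀ → ∀ s, 0 ≤ s → IsIsotropic (f s)) := by
  -- Zero mass would make the Wild rate `l` vanish.
  by_cases h0 : f₀ = 0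
  · refine ⟨fun _ => 0, (isModifiedSolution_iff hC hb hε).2 ⟨h0.symm, fun s _ => ?_⟩,
      fun _ _ => le_rfl, fun _ _ _ => isIsotropic_zero⟩
    have : collisionL1 hC hb hε 0 = 0 := by simp [collisionL1]
    rw [this]
    exact hasDerivWithinAt_const _ _ _
  have hc := rateBound_pos (b := b) hC hε
  have hl : 0 < rateBound C₁ b ε * ‖f₀‖ := mul_pos hc (norm_pos_iff.2 h0)
  set Γ := shifted hC hb hε
  have hpos : ∀ n, wildCoeff Γ (rateBound C₁ b ε * ‖f₀‖) f₀ n ∈ {f : L1 | 0 ≤ f} :=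
    wildCoeff_mem hl hf₀ (le_refl (0 : L1)) (fun y hy z hz => show 0 ≤ y + z from add_nonneg hy hz)
      (fun r hr y hy => show 0 ≤ r • y from smul_nonneg_of_nonneg hr hy) (fun _ hy _ hz => shifted_nonneg hC hb hε hy hz)
  have hM := norm_wildCoeff_le hc h0 hpos
    (fun _ hy _ hz => (norm_shifted hC hb hε hy hz).le)
  have hspos : ∀ s, 0 ≤ s → 0 ≤ wildSum Γ (rateBound C₁ b ε * ‖f₀‖) f₀ s := fun s hs =>
    wildSum_mem hl hM (K := {f : L1 | 0 ≤ f}) isClosed_Ici (le_refl (0 : L1))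
      (fun y hy z hz => show 0 ≤ y + z from add_nonneg hy hz)
      (fun r hr y hy => show 0 ≤ r • y from smul_nonneg_of_nonneg hr hy) hpos hs
  refine ⟨wildSum Γ (rateBound C₁ b ε * ‖f₀‖) f₀, ?_, hspos, fun hi s hs => ?_⟩
  · refine (isModifiedSolution_iff hC hb hε).2 ⟨wildSum_zero _ _ _, fun s hs => ?_⟩
    have hI₀ := integral_eq_norm_of_nonneg hf₀
    -- Conserved mass turns the shift in `Γ` into exactly `l f`, which cancels the damping term.
    have hI : L1.integralCLM (μ := volume) (wildSum Γ (rateBound C₁ b ε * ‖f₀‖) f₀ s) = ‖f₀‖ := by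
      rw [← hI₀]
      rw [← hI₀] at hM hpos hl
      refine apply_wildSum hl hM (fun n => apply_wildCoeff hc ?_ hpos (fun y hy z hz => ?_) n) hs
      · rw [hI₀]; exact norm_pos_iff.2 h0
      · rw [integral_eq_norm_of_nonneg (shifted_nonneg hC hb hε hy hz),
          integral_eq_norm_of_nonneg hy, integral_eq_norm_of_nonneg hz, norm_shifted hC hb hε hy hz]
    refine ((hasDerivAt_wildSum hl hM hs).congr_deriv ?_).hasDerivWithinAt
    rw [shifted_apply, hI, smul_smul, add_sub_cancel_right, collisionL1]
  · refine wildSum_mem hl hM isClosed_isIsotropic isIsotropic_zero (fun _ hy _ hz => hy.add hz)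
      (fun r _ _ hy => hy.smul r) (fun n => ?_) hs
    exact wildCoeff_mem (K := {f : L1 | IsIsotropic f}) hl hi isIsotropic_zero
      (fun _ hy _ hz => hy.add hz) (fun r _ _ hy => hy.smul r)
      (fun _ hy _ hz => hy.shifted hC hb hε hz) n

end Existence

/-! ### Angular integrals. -/

section SphereIntegrals

theorem volume_box_le {δ : ℝ} (hδ : 0 ≤ δ) :
    volume {x : Mom | x 0 ^ 2 ≤ 1 ∧ x 1 ^ 2 ≤ 2 * δ ∧ x 2 ^ 2 ≤ 2 * δ} ≤
      ENNReal.ofReal (16 * δ) := by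
  obtain ⟨d, hd0, hd⟩ : ∃ d : ℝ, 0 ≤ d ∧ d ^ 2 = 2 * δ :=
    ⟨Real.sqrt (2 * δ), Real.sqrt_nonneg _, Real.sq_sqrt (by positivity)⟩
  let L : Fin 3 → ℝ := ![1, d, d]
  have hsub : {x : Mom | x 0 ^ 2 ≤ 1 ∧ x 1 ^ 2 ≤ 2 * δ ∧ x 2 ^ 2 ≤ 2 * δ} ⊆
      WithLp.ofLp ⁻¹' (Icc (-L) L) := by
    rintro x ⟨h0, h1, h2⟩
    have h0' := abs_le.1 (abs_le_of_sq_le_sq (by linarith : x 0 ^ 2 ≤ 1 ^ 2) zero_le_one)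
    have h1' := abs_le.1 (abs_le_of_sq_le_sq (by linarith : x 1 ^ 2 ≤ d ^ 2) hd0)
    have h2' := abs_le.1 (abs_le_of_sq_le_sq (by linarith : x 2 ^ 2 ≤ d ^ 2) hd0)
    refine ⟨fun i => ?_, fun i => ?_⟩ <;> fin_cases i <;> simp [L] <;> linarith
  refine (measure_mono hsub).trans (le_of_eq ?_)
  rw [(PiLp.volume_preserving_ofLp (Fin 3)).measure_preimage measurableSet_Icc.nullMeasurableSet,
    Real.volume_Icc_pi, Fin.prod_univ_three, ← ENNReal.ofReal_mul (by simp [L]),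
    ← ENNReal.ofReal_mul (by simp [L, hd0])]
  congr 1
  simp [L]
  nlinarith

/-- The cone over the cap lies in a box with half sides `1`, `√(2δ)`, `√(2δ)`, of volume `16 δ`. The
dimension factor `3` in the surface measure gives `48`. -/
theorem sphereMeasure_cap_unitVec_le {δ : ℝ} (hδ : 0 ≤ δ) :
    sphereMeasure {w | 1 - inner ℝ (w : Mom) unitVec ≤ δ} ≤ ENNReal.ofReal (48 * δ) := by
  have hms : MeasurableSet {w : S2 | 1 - inner ℝ (w : Mom) unitVec ≤ δ} :=
    measurableSet_le (by fun_prop) measurable_const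
  rw [Measure.toSphere_apply' _ hms]
  have hdim : (Module.finrank ℝ Mom : ENNReal) = ENNReal.ofReal 3 := by simp
  rw [hdim, show 48 * δ = 3 * (16 * δ) by ring, ENNReal.ofReal_mul (by norm_num)]
  gcongr
  refine (measure_mono ?_).trans (volume_box_le hδ)
  rintro _ ⟨t, ht, _, ⟨w, hw, rfl⟩, rfl⟩
  have hn : ‖(w : Mom)‖ = 1 := norm_eq_of_mem_sphere w
  have hs : (w : Mom) 0 ^ 2 + (w : Mom) 1 ^ 2 + (w : Mom) 2 ^ 2 = 1 := by
    have := EuclideanSpace.real_norm_sq_eq (w : Mom)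
    rw [hn, Fin.sum_univ_three] at this
    linarith
  have hw' : 1 - (w : Mom) 0 ≤ δ := by
    have : 1 - inner ℝ (w : Mom) unitVec ≤ δ := hw
    simpa [unitVec, EuclideanSpace.inner_single_right] using this
  have ht2 : t ^ 2 ≤ 1 := by nlinarith [ht.1, ht.2]
  have h01 : (w : Mom) 0 ≤ 1 := by nlinarith [sq_nonneg ((w : Mom) 1), sq_nonneg ((w : Mom) 2)]
  have h02 : -1 ≤ (w : Mom) 0 := by nlinarith [sq_nonneg ((w : Mom) 1), sq_nonneg ((w : Mom) 2)]
  have h3 : (w : Mom) 1 ^ 2 + (w : Mom) 2 ^ 2 ≤ 2 * δ := by nlinarith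
  refine ⟨?_, ?_, ?_⟩ <;>
    simp only [PiLp.smul_apply, smul_eq_mul, mul_pow] <;>
    nlinarith [sq_nonneg ((w : Mom) 0), sq_nonneg ((w : Mom) 1), sq_nonneg ((w : Mom) 2), sq_nonneg t]

theorem sphereMeasure_cap_le {e : Mom} (he : ‖e‖ = 1) {δ : ℝ} (hδ : 0 ≤ δ) :
    sphereMeasure {w | 1 - inner ℝ (w : Mom) e ≤ δ} ≤ ENNReal.ofReal (48 * δ) := by
  obtain ⟨ρ, hρ⟩ := exists_isometry_apply_eq (p := e) (q := unitVec) (he.trans norm_unitVec.symm)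
  have hms : MeasurableSet {w : S2 | 1 - inner ℝ (w : Mom) unitVec ≤ δ} :=
    measurableSet_le (by fun_prop) measurable_const
  refine le_trans (le_of_eq ?_) (((measurePreserving_sphereMap ρ).measure_preimage
    hms.nullMeasurableSet).trans_le (sphereMeasure_cap_unitVec_le hδ))
  congr 1
  ext w
  simp only [mem_preimage, mem_ofPred_eq, sphereMap, ← hρ, ρ.inner_map_map]

/-- Integrals of decreasing functions of the polar angle are controlled by integrals on the half
line. -/
theorem lintegral_antitone_sphere_le {e : Mom} (he : ‖e‖ = 1) {h : ℝ → ℝ} (hm : Measurable h)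
    (h0 : ∀ t, 0 ≤ h t) (ha : AntitoneOn h (Ioi 0)) :
    ∫⁻ w, ENNReal.ofReal (h (1 - inner ℝ (w : Mom) e)) ∂sphereMeasure ≤
      48 * ∫⁻ t in Ioi (0 : ℝ), ENNReal.ofReal (h t) := by
  have hy : Measurable fun w : S2 => 1 - inner ℝ (w : Mom) e := by fun_prop
  have h48 : (48 : ENNReal) = ENNReal.ofReal 48 := by simp
  -- Layer cake: superlevel sets of a decreasing function are initial intervals, their preimages on
  -- the sphere are caps, and the cap bound compares the two measures.
  rw [lintegral_eq_lintegral_meas_lt _ (ae_of_all _ fun w => h0 _) (hm.comp hy).aemeasurable,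
    lintegral_eq_lintegral_meas_lt _ (ae_of_all _ fun w => h0 _) hm.aemeasurable,
    ← lintegral_const_mul' _ _ (by simp)]
  refine lintegral_mono fun s => ?_
  rw [Measure.restrict_apply (measurableSet_lt measurable_const hm)]
  set S : Set ℝ := {t | s < h t} ∩ Ioi 0 with hS
  have hlow : ∀ t ∈ S, ∀ r, 0 < r → r ≤ t → r ∈ S := fun t ht r hr hrt =>
    ⟨lt_of_lt_of_le ht.1 (ha hr ht.2 hrt), hr⟩
  -- Monotonicity is only assumed for positive arguments, so the pole is discarded as a null set.
  have hnull : sphereMeasure {w : S2 | 1 - inner ℝ (w : Mom) e ≤ 0} = 0 :=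
    le_antisymm ((sphereMeasure_cap_le he le_rfl).trans (by simp)) bot_le
  have hcov : {w : S2 | s < h (1 - inner ℝ (w : Mom) e)} ⊆
      {w : S2 | 1 - inner ℝ (w : Mom) e ≤ 0} ∪ {w : S2 | 1 - inner ℝ (w : Mom) e ∈ S} := by
    intro w hw
    by_cases hw0 : 1 - inner ℝ (w : Mom) e ≤ 0
    · exact Or.inl hw0
    · exact Or.inr ⟨hw, not_le.1 hw0⟩
  refine (measure_mono hcov).trans ((measure_union_le _ _).trans ?_)
  rw [hnull, zero_add]
  by_cases hb : BddAbove S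
  · rcases S.eq_empty_or_nonempty with hE | hne
    · simp [hE]
    have hD : 0 ≤ sSup S := by
      obtain ⟨t, ht⟩ := hne
      exact (le_of_lt ht.2).trans (le_csSup hb ht)
    calc sphereMeasure {w : S2 | 1 - inner ℝ (w : Mom) e ∈ S}
        ≤ sphereMeasure {w : S2 | 1 - inner ℝ (w : Mom) e ≤ sSup S} :=
          measure_mono fun w hw => le_csSup hb hw
      _ ≤ ENNReal.ofReal (48 * sSup S) := sphereMeasure_cap_le he hD
      _ = 48 * volume (Ioo 0 (sSup S)) := by
          rw [ENNReal.ofReal_mul (by norm_num), Real.volume_Ioo, sub_zero, h48]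
      _ ≤ 48 * volume S := by
          gcongr
          rintro r ⟨hr0, hr1⟩
          obtain ⟨t, ht, hrt⟩ := exists_lt_of_lt_csSup hne hr1
          exact hlow t ht r hr0 hrt.le
  · have : Ioi 0 ⊆ S := by
      intro r hr
      obtain ⟨t, ht, hrt⟩ := not_bddAbove_iff.1 hb r
      exact hlow t ht r hr hrt.le
    have : volume S = ⊤ := top_le_iff.1 (by rw [← Real.volume_Ioi (a := 0)]; exact measure_mono this)
    rw [this, ENNReal.mul_top (by norm_num)]
    exact le_top

theorem lintegral_Ioi_inv_sq {a c : ℝ} (ha : 0 < a) (hc : 0 < c) :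
    ∫⁻ t in Ioi (0 : ℝ), ENNReal.ofReal (4 / (a + c * t) ^ 2) = ENNReal.ofReal (4 / (a * c)) := by
  have hd : ∀ t ∈ Ici (0 : ℝ), HasDerivAt (fun t : ℝ => -(4 / c) * (a + c * t)⁻¹)
      (4 / (a + c * t) ^ 2) t := by
    intro t ht
    have hp : 0 < a + c * t := by have : 0 ≤ t := ht; positivity
    have := ((((hasDerivAt_id' t).const_mul c).const_add a).inv hp.ne').const_mul (-(4 / c))
    refine this.congr_deriv ?_
    field_simp
  have hlim : Filter.Tendsto (fun t : ℝ => -(4 / c) * (a + c * t)⁻¹) Filter.atTop (nhds 0) := by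
    have : Filter.Tendsto (fun t : ℝ => a + c * t) Filter.atTop Filter.atTop :=
      Filter.tendsto_atTop_add_const_left _ _ (Filter.tendsto_id.const_mul_atTop hc)
    simpa using this.inv_tendsto_atTop.const_mul (-(4 / c))
  have hnn : ∀ t ∈ Ioi (0 : ℝ), 0 ≤ 4 / (a + c * t) ^ 2 := fun t _ => by positivity
  rw [← ofReal_integral_eq_lintegral_ofReal (integrableOn_Ioi_deriv_of_nonneg' hd hnn hlim)
    (ae_of_all _ fun t => by positivity), integral_Ioi_of_hasDerivAt_of_nonneg' hd hnn hlim]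
  congr 1
  field_simp
  ring

/-- The angular average of the inverse square of the outgoing energy. -/
theorem lintegral_inv_norm_outP_sq_le {p q : Mom} (h : 0 < rho p q) :
    ∫⁻ w, ENNReal.ofReal ((‖outP p q (w : Mom)‖ ^ 2)⁻¹) ∂sphereMeasure ≤
      ENNReal.ofReal ((16 * sphereMeasure.real univ + 576) / rho p q ^ 2) := by
  have hE := norm_add_sq_add_rho_sq p q
  have hE0 : 0 ≤ ‖p‖ + ‖q‖ := by positivity
  have hout : ∀ w : S2, (‖outP p q (w : Mom)‖ ^ 2)⁻¹ =
      4 / (‖p‖ + ‖q‖ + inner ℝ (p + q) (w : Mom)) ^ 2 := fun w => by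
    rw [norm_outP h (norm_eq_of_mem_sphere w), div_pow, inv_div]; norm_num
  simp only [hout]
  have hσ := sphereMeasure_real_univ_pos
  set E := ‖p‖ + ‖q‖
  set P := p + q
  set r := rho p q
  have hPE : ‖P‖ < E := by
    by_contra hcon
    have : E ^ 2 ≤ ‖P‖ ^ 2 := pow_le_pow_left₀ hE0 (not_lt.1 hcon) 2
    nlinarith
  -- For small `P` the outgoing energy is comparable to `E`. Otherwise the integrand peaks at `w =
  -- -P/‖P‖`, and integrating the peak gives `1 / ((E - ‖P‖) ‖P‖)`, comparable to `1 / rho²` as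
  -- `rho² = (E - ‖P‖)(E + ‖P‖)`.
  rcases le_or_gt ‖P‖ (E / 2) with hP | hP
  · have hEpos : 0 < E := (norm_nonneg _).trans_lt hPE
    calc _ ≤ ∫⁻ _, ENNReal.ofReal (16 / r ^ 2) ∂sphereMeasure := by
          refine lintegral_mono fun w => ENNReal.ofReal_le_ofReal ?_
          have hw := (abs_le.1 (abs_real_inner_le_norm P (w : Mom))).1
          rw [norm_eq_of_mem_sphere w, mul_one] at hw
          rw [div_le_div_iff₀ (by have : 0 < E + inner ℝ P (w : Mom) := by linarith
                                  positivity) (by positivity)]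
          have h1 : E / 2 ≤ E + inner ℝ P (w : Mom) := by linarith
          have h2 : (E / 2) ^ 2 ≤ (E + inner ℝ P (w : Mom)) ^ 2 := by gcongr
          nlinarith [sq_nonneg ‖P‖]
      _ = ENNReal.ofReal (16 / r ^ 2 * sphereMeasure.real univ) := by
          rw [lintegral_const, ENNReal.ofReal_mul (by positivity), ofReal_measureReal]
      _ ≤ _ := by
          refine ENNReal.ofReal_le_ofReal ?_
          rw [div_mul_eq_mul_div]
          gcongr
          linarith
  · have hP0 : 0 < ‖P‖ := by linarith
    have ha : 0 < E - ‖P‖ := by linarith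
    have he : ‖(-‖P‖⁻¹) • P‖ = 1 := by
      rw [norm_smul, norm_neg, norm_inv, norm_norm, inv_mul_cancel₀ hP0.ne']
    have harg : ∀ w : S2, E + inner ℝ P (w : Mom) =
        (E - ‖P‖) + ‖P‖ * (1 - inner ℝ (w : Mom) ((-‖P‖⁻¹) • P)) := fun w => by
      rw [inner_smul_right, real_inner_comm]; field_simp; ring
    simp only [harg]
    refine (lintegral_antitone_sphere_le he (h := fun t => 4 / ((E - ‖P‖) + ‖P‖ * t) ^ 2)
      (by fun_prop) (fun t => by positivity) ?_).trans ?_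
    · intro s hs t _ hst
      have hs0 : 0 < s := hs
      simp only
      gcongr
    · rw [lintegral_Ioi_inv_sq ha hP0, show (48 : ENNReal) = ENNReal.ofReal 48 by simp,
        ← ENNReal.ofReal_mul (by norm_num)]
      refine ENNReal.ofReal_le_ofReal ?_
      rw [← mul_div_assoc, div_le_div_iff₀ (by positivity) (by positivity),
        show r ^ 2 = (E - ‖P‖) * (E + ‖P‖) by linarith]
      have h3 : E + ‖P‖ ≤ 3 * ‖P‖ := by linarith
      calc 48 * 4 * ((E - ‖P‖) * (E + ‖P‖)) ≤ 48 * 4 * ((E - ‖P‖) * (3 * ‖P‖)) := by gcongr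
        _ = 576 * ((E - ‖P‖) * ‖P‖) := by ring
        _ ≤ _ := by gcongr; linarith

/-- The constant bounding the angular integral of `(1 - cos θ) ^ (-b/2)`. -/
def angularConst (b : ℝ) : ENNReal :=
  48 * ∫⁻ t in Ioc (0 : ℝ) 2, ENNReal.ofReal (t ^ (-(b / 2)))

theorem angularConst_lt_top {b : ℝ} (hb : b < 2) : angularConst b < ⊤ := by
  have hi : IntervalIntegrable (fun t : ℝ => t ^ (-(b / 2))) volume 0 2 :=
    intervalIntegral.intervalIntegrable_rpow' (by linarith)
  exact ENNReal.mul_lt_top (by norm_num) (Integrable.lintegral_lt_top hi.1)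

theorem lintegral_angular_le {b : ℝ} (hb : 0 < b) {e : Mom} (he : ‖e‖ = 1) :
    ∫⁻ w, ENNReal.ofReal ((1 - inner ℝ (w : Mom) e) ^ (-(b / 2))) ∂sphereMeasure ≤
      angularConst b := by
  let h : ℝ → ℝ := (Icc 0 2).indicator fun t => t ^ (-(b / 2))
  have hm : Measurable h := (by fun_prop : Measurable fun t : ℝ => t ^ (-(b / 2))).indicator
    measurableSet_Icc
  have h0 : ∀ t, 0 ≤ h t := fun t => indicator_nonneg (fun t ht => Real.rpow_nonneg ht.1 _) t
  have ha : AntitoneOn h (Ioi 0) := by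
    intro s hs t ht hst
    have hs0 : 0 < s := hs
    by_cases ht2 : t ≤ 2
    · simp only [h]
      rw [indicator_of_mem (mem_Icc.2 ⟨le_of_lt ht, ht2⟩),
        indicator_of_mem (mem_Icc.2 ⟨hs0.le, hst.trans ht2⟩)]
      exact Real.rpow_le_rpow_of_nonpos hs0 hst (by linarith)
    · have : h t = 0 := indicator_of_notMem (fun hmem => ht2 hmem.2) _
      rw [this]; exact h0 s
  have key := lintegral_antitone_sphere_le he hm h0 ha
  have hL : ∀ w : S2, h (1 - inner ℝ (w : Mom) e) = (1 - inner ℝ (w : Mom) e) ^ (-(b / 2)) := by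
    intro w
    have := abs_le.1 (abs_real_inner_le_norm (w : Mom) e)
    rw [norm_eq_of_mem_sphere w, he, mul_one] at this
    exact indicator_of_mem (mem_Icc.2 ⟨by linarith, by linarith⟩) _
  simp only [hL] at key
  refine key.trans (le_of_eq ?_)
  rw [angularConst]
  congr 1
  have : ∀ t, ENNReal.ofReal (h t) = (Icc 0 2).indicator
      (fun t : ℝ => ENNReal.ofReal (t ^ (-(b / 2)))) t := fun t => by
    by_cases ht : t ∈ Icc (0 : ℝ) 2
    · simp only [h, indicator_of_mem ht]
    · simp only [h, indicator_of_notMem ht, ENNReal.ofReal_zero]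
  simp only [this]
  rw [setLIntegral_indicator measurableSet_Icc, show Icc (0 : ℝ) 2 ∩ Ioi 0 = Ioc 0 2 by
    ext t; simp only [mem_inter_iff, mem_Icc, mem_Ioi, mem_Ioc]; grind]

/-- One minus the cosine of the angle between two momenta. -/
def angle (p q : Mom) : ℝ := 1 - inner ℝ p q / (‖p‖ * ‖q‖)

@[fun_prop]
theorem _root_.Measurable.massless_angle {α : Type*} [MeasurableSpace α] {f g : α → Mom}
    (hf : Measurable f) (hg : Measurable g) : Measurable fun x => angle (f x) (g x) := by
  unfold angle; fun_prop

/-- For isotropic functions the angular factor can be averaged. -/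
theorem lintegral_isotropic_mul_angle_le {b : ℝ} (hb : 0 < b) {p : Mom} (hp : p ≠ 0)
    {F : ℝ → ENNReal} (hF : Measurable F) :
    sphereMeasure univ * ∫⁻ q : Mom, F ‖q‖ * ENNReal.ofReal (angle p q ^ (-(b / 2))) ≤
      angularConst b * ∫⁻ q : Mom, F ‖q‖ := by
  have hn : 0 < ‖p‖ := norm_pos_iff.2 hp
  have hg : Measurable fun r : ℝ => ENNReal.ofReal (r ^ 2) * F r := by fun_prop
  have h1 : ∫⁻ q : Mom, F ‖q‖ = (∫⁻ r in Ioi (0 : ℝ), ENNReal.ofReal (r ^ 2) * F r) *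
      sphereMeasure univ := by
    rw [lintegral_polar _ (by fun_prop), ← lintegral_mul_const _ hg]
    refine setLIntegral_congr_fun measurableSet_Ioi fun r hr => ?_
    have hr0 : 0 < r := hr
    simp only [norm_smul, norm_eq_of_mem_sphere, mul_one, Real.norm_of_nonneg hr0.le,
      lintegral_const, mul_assoc]
  have h2 : ∫⁻ q : Mom, F ‖q‖ * ENNReal.ofReal (angle p q ^ (-(b / 2))) ≤
      (∫⁻ r in Ioi (0 : ℝ), ENNReal.ofReal (r ^ 2) * F r) * angularConst b := by
    rw [lintegral_polar _ (by fun_prop), ← lintegral_mul_const _ hg]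
    refine setLIntegral_mono' measurableSet_Ioi fun r hr => ?_
    have hr0 : 0 < r := hr
    have hang : ∀ w : S2, angle p (r • (w : Mom)) = 1 - inner ℝ (w : Mom) (‖p‖⁻¹ • p) := by
      intro w
      rw [angle, norm_smul, norm_eq_of_mem_sphere w, Real.norm_of_nonneg hr0.le, inner_smul_right,
        inner_smul_right, real_inner_comm]
      field_simp
    have he : ‖‖p‖⁻¹ • p‖ = 1 := norm_inv_smul hp
    simp only [norm_smul, norm_eq_of_mem_sphere, mul_one, Real.norm_of_nonneg hr0.le, hang]
    rw [lintegral_const_mul _ (by fun_prop), ← mul_assoc]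
    gcongr
    exact lintegral_angular_le hb he
  rw [h1]
  calc _ ≤ sphereMeasure univ *
      ((∫⁻ r in Ioi (0 : ℝ), ENNReal.ofReal (r ^ 2) * F r) * angularConst b) := by gcongr
    _ = _ := by ring

end SphereIntegrals

/-! ### The quadratic bound for the weighted gain term. -/

section Moments

/-- A weight dominating all powers of the energy with exponent in `[-2, 2]`. -/
def momentWeight (p : Mom) : ℝ := 1 + ‖p‖ ^ 2 + (‖p‖ ^ 2)⁻¹

/-- The truncated weight. -/
def cutWeight (R : ℝ) (p : Mom) : ℝ := min (momentWeight p) R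

@[fun_prop]
theorem measurable_momentWeight : Measurable momentWeight := by
  unfold momentWeight; fun_prop

@[fun_prop]
theorem measurable_cutWeight (R : ℝ) : Measurable (cutWeight R) :=
  measurable_momentWeight.min measurable_const

theorem one_le_momentWeight (p : Mom) : 1 ≤ momentWeight p := by
  unfold momentWeight
  have : 0 ≤ ‖p‖ ^ 2 := by positivity
  have : 0 ≤ (‖p‖ ^ 2)⁻¹ := by positivity
  linarith

theorem rpow_le_weight {x m : ℝ} (hx : 0 < x) (h1 : -2 ≤ m) (h2 : m ≤ 2) :
    x ^ m ≤ 1 + x ^ 2 + (x ^ 2)⁻¹ := by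
  have hp : 0 ≤ (x ^ 2)⁻¹ := by positivity
  rcases le_total 1 x with h | h
  · have : x ^ m ≤ x ^ (2 : ℝ) := Real.rpow_le_rpow_of_exponent_le h h2
    rw [Real.rpow_two] at this
    linarith
  · have : x ^ m ≤ x ^ (-2 : ℝ) := Real.rpow_le_rpow_of_exponent_ge hx h h1
    rw [Real.rpow_neg hx.le, Real.rpow_two] at this
    nlinarith [sq_nonneg x]

theorem norm_rpow_le_momentWeight (p : Mom) {m : ℝ} (h1 : -2 ≤ m) (h2 : m ≤ 2) :
    ‖p‖ ^ m ≤ momentWeight p := by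
  rcases (norm_nonneg p).eq_or_lt with h | h
  · rw [← h]
    exact (Real.zero_rpow_le_one m).trans (one_le_momentWeight p)
  · exact rpow_le_weight h h1 h2

theorem angle_comm (p q : Mom) : angle p q = angle q p := by
  rw [angle, angle, real_inner_comm, mul_comm ‖p‖]

theorem cutKernel_comm (b ε : ℝ) (p q : Mom) : cutKernel b ε p q = cutKernel b ε q p := by
  rw [cutKernel, cutKernel, rho_comm, mul_comm ‖p‖]

theorem rho_sq_eq_angle {p q : Mom} (h : 0 < ‖p‖ * ‖q‖) :
    rho p q ^ 2 = 2 * (‖p‖ * ‖q‖) * angle p q := by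
  rw [rho_sq, angle]
  generalize ‖p‖ * ‖q‖ = N at *
  field_simp

theorem angle_le_two (p q : Mom) : angle p q ≤ 2 := by
  have := (abs_le.1 (abs_real_inner_div_norm_mul_norm_le_one p q)).1
  rw [angle]; linarith

theorem rho_rpow_neg_le {b : ℝ} (hb : 0 < b) {p q : Mom} (h : 0 < rho p q) :
    rho p q ^ (-b) ≤ angle p q ^ (-(b / 2)) * (‖p‖ ^ (-(b / 2)) * ‖q‖ ^ (-(b / 2))) := by
  have hpq := norm_mul_norm_pos_of_rho_pos h
  have hs := rho_sq_eq_angle hpq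
  have ha : 0 < angle p q := by
    have : 0 < 2 * (‖p‖ * ‖q‖) * angle p q := by rw [← hs]; positivity
    exact pos_of_mul_pos_right this (by positivity)
  have h1 : rho p q ^ (-b) = (rho p q ^ 2) ^ (-(b / 2)) := by
    rw [← Real.rpow_natCast, ← Real.rpow_mul h.le]; congr 1; push_cast; ring
  rw [h1, hs, Real.mul_rpow (by positivity) ha.le, Real.mul_rpow (by norm_num) hpq.le,
    Real.mul_rpow (norm_nonneg _) (norm_nonneg _), mul_comm (angle p q ^ _)]
  have h2 : (2 : ℝ) ^ (-(b / 2)) ≤ 1 :=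
    Real.rpow_le_one_of_one_le_of_nonpos (by norm_num) (by linarith)
  have h3 : 0 ≤ ‖p‖ ^ (-(b / 2)) * ‖q‖ ^ (-(b / 2)) := by positivity
  have h4 : 0 ≤ angle p q ^ (-(b / 2)) := Real.rpow_nonneg ha.le _
  exact mul_le_mul_of_nonneg_right (mul_le_of_le_one_left h3 h2) h4

theorem cutKernel_eq {b ε : ℝ} {p q : Mom} (hε : 0 < ε) (h : ε ≤ rho p q) :
    cutKernel b ε p q = rho p q ^ 2 * rho p q ^ (-b) / (‖p‖ * ‖q‖) := by
  rw [cutKernel, if_pos h, ← Real.rpow_two, ← Real.rpow_add (hε.trans_le h), sub_eq_add_neg]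

theorem cutKernel_le_angle {b ε : ℝ} (hb : 0 < b) {p q : Mom} (hε : 0 < ε) (h : ε ≤ rho p q) :
    cutKernel b ε p q ≤
      4 * (angle p q ^ (-(b / 2)) * (‖p‖ ^ (-(b / 2)) * ‖q‖ ^ (-(b / 2)))) := by
  have hr := hε.trans_le h
  have hpq := norm_mul_norm_pos_of_rho_pos hr
  rw [cutKernel_eq hε h, div_le_iff₀ hpq]
  have h1 := rho_sq_le p q
  have h2 := rho_rpow_neg_le hb hr
  calc rho p q ^ 2 * rho p q ^ (-b) ≤ 4 * (‖p‖ * ‖q‖) *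
      (angle p q ^ (-(b / 2)) * (‖p‖ ^ (-(b / 2)) * ‖q‖ ^ (-(b / 2)))) := by gcongr
    _ = _ := by ring

theorem half_le_angle_rpow {b : ℝ} (hb : 0 < b) (hb2 : b < 2) {p q : Mom} (h : 0 < rho p q) :
    1 / 2 ≤ angle p q ^ (-(b / 2)) := by
  have hpq := norm_mul_norm_pos_of_rho_pos h
  have ha : 0 < angle p q := by
    have : 0 < 2 * (‖p‖ * ‖q‖) * angle p q := by rw [← rho_sq_eq_angle hpq]; positivity
    exact pos_of_mul_pos_right this (by positivity)
  calc (1 / 2 : ℝ) = 2 ^ (-1 : ℝ) := by rw [Real.rpow_neg_one]; norm_num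
    _ ≤ 2 ^ (-(b / 2)) := Real.rpow_le_rpow_of_exponent_le (by norm_num) (by linarith)
    _ ≤ _ := Real.rpow_le_rpow_of_nonpos ha (angle_le_two p q) (by linarith)

/-- Beyond this level the truncation of the weight is compatible with the cutoff of the kernel. -/
def truncationLevel (b ε : ℝ) : ℝ := 2 + 4 * ε ^ (-b) + 16 * (4 * ε ^ (-b)) / ε ^ 4

/-- Saturation of the weight at `p` is harmless. Against `R` the uniform kernel bound suffices.
Against the weight of `q`: if `‖p‖ ≥ 1`, then `‖p‖^(-b/2) ≤ 1`; if `‖p‖ < 1`, then `p` is very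
small, and `rho ≥ ε` forces `q` so large that `‖q‖²` exceeds the kernel. -/
theorem cutKernel_le_of_lt_momentWeight {b ε R : ℝ} (hb : 0 < b) (hb2 : b < 2) (hε : 0 < ε)
    (hR : truncationLevel b ε ≤ R) {p q : Mom} (h : ε ≤ rho p q) (hp : R < momentWeight p) :
    cutKernel b ε p q ≤ 4 * angle p q ^ (-(b / 2)) * cutWeight R q := by
  have hr := hε.trans_le h
  have hpq := norm_mul_norm_pos_of_rho_pos hr
  have hp0 : 0 < ‖p‖ := pos_of_mul_pos_left hpq (norm_nonneg _)
  have hq0 : 0 < ‖q‖ := pos_of_mul_pos_right hpq (norm_nonneg _)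
  have hk := cutKernel_le hb hε p q
  have ha := half_le_angle_rpow hb hb2 hr
  have hκ : 0 < 4 * ε ^ (-b) := by positivity
  have h16 : 0 < 16 * (4 * ε ^ (-b)) / ε ^ 4 := by positivity
  unfold truncationLevel at hR
  have hw1 := one_le_momentWeight q
  rw [cutWeight, mul_min_of_nonneg _ _ (by positivity)]
  refine le_min ?_ (by nlinarith)
  rcases le_or_gt 1 ‖p‖ with h1 | h1
  · refine (cutKernel_le_angle hb hε h).trans ?_
    rw [← mul_assoc]
    have h2 : ‖p‖ ^ (-(b / 2)) ≤ 1 := Real.rpow_le_one_of_one_le_of_nonpos h1 (by linarith)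
    have h3 : ‖q‖ ^ (-(b / 2)) ≤ momentWeight q :=
      norm_rpow_le_momentWeight q (by linarith) (by linarith)
    calc 4 * angle p q ^ (-(b / 2)) * (‖p‖ ^ (-(b / 2)) * ‖q‖ ^ (-(b / 2))) ≤
        4 * angle p q ^ (-(b / 2)) * (1 * momentWeight q) := by gcongr
      _ = _ := by rw [one_mul]
  · have h2 : R - 2 < (‖p‖ ^ 2)⁻¹ := by
      unfold momentWeight at hp
      have : ‖p‖ ^ 2 ≤ 1 := pow_le_one₀ hp0.le h1.le
      linarith
    have h3 : ε ^ 2 ≤ 4 * (‖p‖ * ‖q‖) := (pow_le_pow_left₀ hε.le h 2).trans (rho_sq_le p q)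
    have h4 : 4 * ε ^ (-b) ≤ ‖q‖ ^ 2 := by
      have h5 : ε ^ 4 ≤ 16 * (‖p‖ ^ 2 * ‖q‖ ^ 2) := by
        calc ε ^ 4 = (ε ^ 2) ^ 2 := by ring
          _ ≤ (4 * (‖p‖ * ‖q‖)) ^ 2 := by gcongr
          _ = _ := by ring
      have h6 : 16 * (4 * ε ^ (-b)) / ε ^ 4 ≤ (‖p‖ ^ 2)⁻¹ := by linarith
      rw [div_le_iff₀ (by positivity), inv_mul_eq_div, le_div_iff₀ (by positivity)] at h6
      have h7 : 16 * (4 * ε ^ (-b)) * ‖p‖ ^ 2 ≤ 16 * (‖p‖ ^ 2 * ‖q‖ ^ 2) := h6.trans h5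
      have h8 : 0 < ‖p‖ ^ 2 := by positivity
      nlinarith
    have h5 : ‖q‖ ^ 2 ≤ momentWeight q := by
      unfold momentWeight
      have : 0 ≤ (‖q‖ ^ 2)⁻¹ := by positivity
      linarith
    nlinarith

/-- The constant in the bound of the weight after collision. -/
def weightConst : ℝ := 36 * sphereMeasure.real univ + 576

theorem cutKernel_mul_lintegral_le_of_le {b ε R : ℝ} (hb : 0 < b) (hb2 : b < 2) (hε : 0 < ε)
    {p q : Mom} (h : ε ≤ rho p q) :
    ENNReal.ofReal (cutKernel b ε p q) *
      ∫⁻ w, ENNReal.ofReal (cutWeight R (outP p q (w : Mom))) ∂sphereMeasure ≤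
    ENNReal.ofReal (weightConst * (angle p q ^ (-(b / 2)) *
      (momentWeight p * momentWeight q))) := by
  have hr := hε.trans_le h
  have hpq := norm_mul_norm_pos_of_rho_pos hr
  have hp0 : 0 < ‖p‖ := pos_of_mul_pos_left hpq (norm_nonneg _)
  have hq0 : 0 < ‖q‖ := pos_of_mul_pos_right hpq (norm_nonneg _)
  have hσ := sphereMeasure_real_univ_pos
  have hint : ∫⁻ w, ENNReal.ofReal (cutWeight R (outP p q (w : Mom))) ∂sphereMeasure ≤
      ENNReal.ofReal ((1 + (‖p‖ + ‖q‖) ^ 2) * sphereMeasure.real univ +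
        (16 * sphereMeasure.real univ + 576) / rho p q ^ 2) := by
    calc _ ≤ ∫⁻ w, (ENNReal.ofReal (1 + (‖p‖ + ‖q‖) ^ 2) +
          ENNReal.ofReal ((‖outP p q (w : Mom)‖ ^ 2)⁻¹)) ∂sphereMeasure := by
          refine lintegral_mono fun w => ?_
          rw [← ENNReal.ofReal_add (by positivity) (by positivity)]
          refine ENNReal.ofReal_le_ofReal ((min_le_left _ _).trans ?_)
          unfold momentWeight
          have := norm_outP_le hr (norm_eq_of_mem_sphere w)
          gcongr
      _ ≤ _ := by
          rw [lintegral_add_left measurable_const, lintegral_const,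
            ENNReal.ofReal_add (p := (1 + (‖p‖ + ‖q‖) ^ 2) * sphereMeasure.real univ) (by positivity)
              (by positivity), ENNReal.ofReal_mul (by positivity), ofReal_measureReal]
          gcongr
          exact lintegral_inv_norm_outP_sq_le hr
  refine (mul_le_mul_right hint _).trans ?_
  rw [← ENNReal.ofReal_mul (cutKernel_nonneg _ _ _ _)]
  refine ENNReal.ofReal_le_ofReal ?_
  have ha : 0 ≤ angle p q ^ (-(b / 2)) := by linarith [half_le_angle_rpow hb hb2 hr]
  have hpow : ∀ x : ℝ, 0 < x → ∀ n : ℕ, x ^ n * x ^ (-(b / 2)) = x ^ ((n : ℝ) - b / 2) := by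
    intro x hx n
    rw [← Real.rpow_natCast, ← Real.rpow_add hx, sub_eq_add_neg]
  have hwp := one_le_momentWeight p
  have hwq := one_le_momentWeight q
  have up : ‖p‖ ^ (-(b / 2)) ≤ momentWeight p :=
    norm_rpow_le_momentWeight p (by linarith) (by linarith)
  have uq : ‖q‖ ^ (-(b / 2)) ≤ momentWeight q :=
    norm_rpow_le_momentWeight q (by linarith) (by linarith)
  have vp : ‖p‖ ^ 2 * ‖p‖ ^ (-(b / 2)) ≤ momentWeight p := by
    rw [hpow _ hp0]
    exact norm_rpow_le_momentWeight p (by push_cast; linarith) (by push_cast; linarith)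
  have vq : ‖q‖ ^ 2 * ‖q‖ ^ (-(b / 2)) ≤ momentWeight q := by
    rw [hpow _ hq0]
    exact norm_rpow_le_momentWeight q (by push_cast; linarith) (by push_cast; linarith)
  have zp : ‖p‖ ^ (-(b / 2)) / ‖p‖ ≤ momentWeight p := by
    rw [← Real.rpow_sub_one hp0.ne']
    exact norm_rpow_le_momentWeight p (by linarith) (by linarith)
  have zq : ‖q‖ ^ (-(b / 2)) / ‖q‖ ≤ momentWeight q := by
    rw [← Real.rpow_sub_one hq0.ne']
    exact norm_rpow_le_momentWeight q (by linarith) (by linarith)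
  have hx : 0 ≤ ‖p‖ ^ (-(b / 2)) := by positivity
  have hy : 0 ≤ ‖q‖ ^ (-(b / 2)) := by positivity
  set W := momentWeight p * momentWeight q with hW
  have e1 : ‖p‖ ^ (-(b / 2)) * ‖q‖ ^ (-(b / 2)) ≤ W :=
    mul_le_mul up uq hy (by linarith)
  have e2 : (‖p‖ ^ 2 * ‖p‖ ^ (-(b / 2))) * ‖q‖ ^ (-(b / 2)) ≤ W :=
    mul_le_mul vp uq hy (by linarith)
  have e3 : ‖p‖ ^ (-(b / 2)) * (‖q‖ ^ 2 * ‖q‖ ^ (-(b / 2))) ≤ W :=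
    mul_le_mul up vq (by positivity) (by linarith)
  have e4 : (‖p‖ ^ (-(b / 2)) / ‖p‖) * (‖q‖ ^ (-(b / 2)) / ‖q‖) ≤ W :=
    mul_le_mul zp zq (by positivity) (by linarith)
  have k1 := cutKernel_le_angle hb hε h
  -- Here `20 = 4 + 8 + 8`, from `(x + y)² ≤ 2x² + 2y²`; all exponents that occur lie in `[-2, 2]`.
  have t1 : cutKernel b ε p q * (1 + (‖p‖ + ‖q‖) ^ 2) ≤ angle p q ^ (-(b / 2)) * (20 * W) := by
    have hle : 1 + (‖p‖ + ‖q‖) ^ 2 ≤ 1 + 2 * ‖p‖ ^ 2 + 2 * ‖q‖ ^ 2 := by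
      nlinarith [sq_nonneg (‖p‖ - ‖q‖)]
    calc _ ≤ 4 * (angle p q ^ (-(b / 2)) * (‖p‖ ^ (-(b / 2)) * ‖q‖ ^ (-(b / 2)))) *
          (1 + 2 * ‖p‖ ^ 2 + 2 * ‖q‖ ^ 2) := by gcongr
      _ = angle p q ^ (-(b / 2)) * (4 * (‖p‖ ^ (-(b / 2)) * ‖q‖ ^ (-(b / 2))) +
          8 * ((‖p‖ ^ 2 * ‖p‖ ^ (-(b / 2))) * ‖q‖ ^ (-(b / 2))) +
          8 * (‖p‖ ^ (-(b / 2)) * (‖q‖ ^ 2 * ‖q‖ ^ (-(b / 2))))) := by ring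
      _ ≤ _ := by gcongr; linarith
  -- The `rho⁻²` from the angular mean cancels the `rho²` of the kernel. This leaves the exponent
  -- `-1 - b/2` on each energy, above `-2` because `b < 2`.
  have t2 : cutKernel b ε p q / rho p q ^ 2 ≤ angle p q ^ (-(b / 2)) * W := by
    have hs := rho_rpow_neg_le hb hr
    rw [cutKernel_eq hε h]
    calc _ = rho p q ^ (-b) / (‖p‖ * ‖q‖) := by field_simp
      _ ≤ angle p q ^ (-(b / 2)) * (‖p‖ ^ (-(b / 2)) * ‖q‖ ^ (-(b / 2))) / (‖p‖ * ‖q‖) := by gcongr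
      _ = angle p q ^ (-(b / 2)) * ((‖p‖ ^ (-(b / 2)) / ‖p‖) * (‖q‖ ^ (-(b / 2)) / ‖q‖)) := by
        field_simp
      _ ≤ _ := by gcongr
  calc _ = cutKernel b ε p q * (1 + (‖p‖ + ‖q‖) ^ 2) * sphereMeasure.real univ +
        cutKernel b ε p q / rho p q ^ 2 * (16 * sphereMeasure.real univ + 576) := by ring
    _ ≤ angle p q ^ (-(b / 2)) * (20 * W) * sphereMeasure.real univ +
        angle p q ^ (-(b / 2)) * W * (16 * sphereMeasure.real univ + 576) := by gcongr
    _ = _ := by rw [weightConst]; ring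

theorem cutKernel_mul_lintegral_cutWeight_le {b ε R : ℝ} (hb : 0 < b) (hb2 : b < 2) (hε : 0 < ε)
    (hR : truncationLevel b ε ≤ R) (p q : Mom) :
    ENNReal.ofReal (cutKernel b ε p q) *
      ∫⁻ w, ENNReal.ofReal (cutWeight R (outP p q (w : Mom))) ∂sphereMeasure ≤
    ENNReal.ofReal weightConst * (ENNReal.ofReal (angle p q ^ (-(b / 2))) *
      (ENNReal.ofReal (cutWeight R p) * ENNReal.ofReal (cutWeight R q))) := by
  by_cases h : ε ≤ rho p q
  swap
  · simp [cutKernel, h]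
  have hr := hε.trans_le h
  have hσ := sphereMeasure_real_univ_pos
  have ha : 0 ≤ angle p q ^ (-(b / 2)) := by linarith [half_le_angle_rpow hb hb2 hr]
  have hR0 : 0 ≤ R := by
    refine le_trans ?_ hR
    unfold truncationLevel; positivity
  have hw0 : ∀ k : Mom, 0 ≤ cutWeight R k := fun k =>
    le_min (zero_le_one.trans (one_le_momentWeight k)) hR0
  have hc : 0 ≤ weightConst := by unfold weightConst; positivity
  rw [← ENNReal.ofReal_mul (hw0 p), ← ENNReal.ofReal_mul ha, ← ENNReal.ofReal_mul hc]
  by_cases hp : momentWeight p ≤ R ∧ momentWeight q ≤ R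
  · rw [cutWeight, cutWeight, min_eq_left hp.1, min_eq_left hp.2]
    exact cutKernel_mul_lintegral_le_of_le hb hb2 hε h
  -- When a weight is saturated, the outgoing weight is bounded by `R`, and this `R` is paid for by
  -- the saturated incoming weight.
  have key : cutKernel b ε p q * R ≤
      4 * angle p q ^ (-(b / 2)) * (cutWeight R p * cutWeight R q) := by
    rcases not_and_or.1 hp with hp | hp
    · have := cutKernel_le_of_lt_momentWeight hb hb2 hε hR h (not_le.1 hp)
      rw [show cutWeight R p = R from min_eq_right (not_le.1 hp).le]
      nlinarith
    · have := cutKernel_le_of_lt_momentWeight hb hb2 hε hR (rho_comm p q ▸ h) (not_le.1 hp)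
      rw [show cutWeight R q = R from min_eq_right (not_le.1 hp).le]
      rw [cutKernel_comm, angle_comm] at this
      nlinarith
  have hint : ∫⁻ w, ENNReal.ofReal (cutWeight R (outP p q (w : Mom))) ∂sphereMeasure ≤
      ENNReal.ofReal (R * sphereMeasure.real univ) := by
    calc _ ≤ ∫⁻ _, ENNReal.ofReal R ∂sphereMeasure :=
          lintegral_mono fun w => ENNReal.ofReal_le_ofReal (min_le_right _ _)
      _ = _ := by rw [lintegral_const, ENNReal.ofReal_mul hR0, ofReal_measureReal]
  refine (mul_le_mul_right hint _).trans ?_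
  rw [← ENNReal.ofReal_mul (cutKernel_nonneg _ _ _ _)]
  refine ENNReal.ofReal_le_ofReal ?_
  have hwp := hw0 p
  have hwq := hw0 q
  calc cutKernel b ε p q * (R * sphereMeasure.real univ) =
        cutKernel b ε p q * R * sphereMeasure.real univ := by ring
    _ ≤ 4 * angle p q ^ (-(b / 2)) * (cutWeight R p * cutWeight R q) *
        sphereMeasure.real univ := by gcongr
    _ = 4 * sphereMeasure.real univ * (angle p q ^ (-(b / 2)) *
        (cutWeight R p * cutWeight R q)) := by ring
    _ ≤ _ := by
        refine mul_le_mul_of_nonneg_right ?_ (by positivity)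
        unfold weightConst; linarith

/-- The constant in the quadratic bound of the growth of the weighted norm. -/
def growthConst (C₁ b : ℝ) : ENNReal :=
  ENNReal.ofReal C₁ * (ENNReal.ofReal weightConst * ((sphereMeasure univ)⁻¹ * angularConst b))

theorem growthConst_lt_top (C₁ : ℝ) {b : ℝ} (hb : b < 2) : growthConst C₁ b < ⊤ :=
  ENNReal.mul_lt_top ENNReal.ofReal_lt_top (ENNReal.mul_lt_top ENNReal.ofReal_lt_top
    (ENNReal.mul_lt_top (ENNReal.inv_lt_top.2
      (Measure.measure_univ_pos.2 (Measure.toSphere_ne_zero _))) (angularConst_lt_top hb)))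

theorem lintegral_cutWeight_gain_le {C₁ b ε R : ℝ} (hC : 0 < C₁) (hb : 0 < b) (hb2 : b < 2)
    (hε : 0 < ε) (hR : truncationLevel b ε ≤ R) {f : L1} (hf : 0 ≤ f) (hi : IsIsotropic f) :
    ∫⁻ p, ENNReal.ofReal (cutWeight R p) *
        ENNReal.ofReal ((isBilinearKernel_gain hC hb hε).clm f f p) ≤
      growthConst C₁ b * (∫⁻ p, ENNReal.ofReal (cutWeight R p) * ENNReal.ofReal (f p)) ^ 2 := by
  obtain ⟨u, hu, hfu⟩ := hi
  have hfm := (Lp.stronglyMeasurable f).measurable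
  have hσ0 : sphereMeasure univ ≠ 0 :=
    (Measure.measure_univ_pos.2 (Measure.toSphere_ne_zero _)).ne'
  set I := ∫⁻ p, ENNReal.ofReal (cutWeight R p) * ENNReal.ofReal (f p) with hI
  let F : ℝ → ENNReal := fun r =>
    ENNReal.ofReal (min (1 + r ^ 2 + (r ^ 2)⁻¹) R) * ENNReal.ofReal (u r)
  have hF : Measurable F := by fun_prop
  have hFI : ∫⁻ q : Mom, F ‖q‖ = I := by
    refine lintegral_congr_ae ?_
    filter_upwards [hfu] with q hq
    rw [hq]; rfl
  -- Isotropy enters here: the singular angular factor is replaced by its mean over the sphere.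
  have hinner : ∀ p : Mom, p ≠ 0 → ∫⁻ q, ENNReal.ofReal (angle p q ^ (-(b / 2))) *
      (ENNReal.ofReal (cutWeight R q) * ENNReal.ofReal (f q)) ≤
      (sphereMeasure univ)⁻¹ * angularConst b * I := by
    intro p hp
    have h1 := lintegral_isotropic_mul_angle_le hb hp hF
    rw [hFI] at h1
    have h2 : ∫⁻ q, ENNReal.ofReal (angle p q ^ (-(b / 2))) *
        (ENNReal.ofReal (cutWeight R q) * ENNReal.ofReal (f q)) =
        ∫⁻ q : Mom, F ‖q‖ * ENNReal.ofReal (angle p q ^ (-(b / 2))) := by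
      refine lintegral_congr_ae ?_
      filter_upwards [hfu] with q hq
      rw [hq, mul_comm]; rfl
    rw [h2, mul_assoc, ← one_mul (∫⁻ q : Mom, F ‖q‖ * _),
      ← ENNReal.inv_mul_cancel hσ0 (measure_ne_top _ _), mul_assoc]
    gcongr
  have hmW : Measurable fun p => ENNReal.ofReal (cutWeight R p) := by fun_prop
  rw [lintegral_mul_gain hC hb hε hf hf hmW, growthConst, mul_assoc]
  gcongr
  have hne : ∀ᵐ p : Mom, p ≠ 0 := by simp [ae_iff]
  calc ∫⁻ p, ∫⁻ q, ENNReal.ofReal (cutKernel b ε p q) *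
        ((ENNReal.ofReal (f p) * ENNReal.ofReal (f q)) *
          ∫⁻ w, ENNReal.ofReal (cutWeight R (outP p q (w : Mom))) ∂sphereMeasure)
      ≤ ∫⁻ p, ∫⁻ q, ENNReal.ofReal weightConst *
          ((ENNReal.ofReal (cutWeight R p) * ENNReal.ofReal (f p)) *
          (ENNReal.ofReal (angle p q ^ (-(b / 2))) *
          (ENNReal.ofReal (cutWeight R q) * ENNReal.ofReal (f q)))) := by
        refine lintegral_mono fun p => lintegral_mono fun q => ?_
        have := cutKernel_mul_lintegral_cutWeight_le hb hb2 hε hR p q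
        calc _ = (ENNReal.ofReal (f p) * ENNReal.ofReal (f q)) *
              (ENNReal.ofReal (cutKernel b ε p q) *
              ∫⁻ w, ENNReal.ofReal (cutWeight R (outP p q (w : Mom))) ∂sphereMeasure) := by ring
          _ ≤ (ENNReal.ofReal (f p) * ENNReal.ofReal (f q)) * (ENNReal.ofReal weightConst *
              (ENNReal.ofReal (angle p q ^ (-(b / 2))) *
              (ENNReal.ofReal (cutWeight R p) * ENNReal.ofReal (cutWeight R q)))) := by gcongr
          _ = _ := by ring
    _ = ENNReal.ofReal weightConst * ∫⁻ p, (ENNReal.ofReal (cutWeight R p) * ENNReal.ofReal (f p)) *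
          ∫⁻ q, (ENNReal.ofReal (angle p q ^ (-(b / 2))) *
          (ENNReal.ofReal (cutWeight R q) * ENNReal.ofReal (f q))) := by
        rw [← lintegral_const_mul' _ _ ENNReal.ofReal_ne_top]
        refine lintegral_congr fun p => ?_
        rw [lintegral_const_mul' _ _ ENNReal.ofReal_ne_top,
          lintegral_const_mul' _ _ (ENNReal.mul_ne_top ENNReal.ofReal_ne_top ENNReal.ofReal_ne_top)]
    _ ≤ ENNReal.ofReal weightConst * ∫⁻ p, (ENNReal.ofReal (cutWeight R p) * ENNReal.ofReal (f p)) *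
          ((sphereMeasure univ)⁻¹ * angularConst b * I) := by
        refine mul_le_mul_right (lintegral_mono_ae ?_) _
        filter_upwards [hne] with p hp
        exact mul_le_mul_right (hinner p hp) _
    _ = ENNReal.ofReal weightConst * ((sphereMeasure univ)⁻¹ * angularConst b) * I ^ 2 := by
        rw [lintegral_mul_const _ (by fun_prop), ← hI]; ring

end Moments

/-! ### Propagation of moments. -/

section MomentPropagation

/-- A bounded weight gives a continuous functional on `L¹`, so its moment can be differentiated
along a solution. This is the reason for truncating. -/
theorem exists_clm_eq_integral_mul {W : Mom → ℝ} (hW : Measurable W) {R : ℝ}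
    (h0 : ∀ p, 0 ≤ W p) (hR : ∀ p, W p ≤ R) :
    ∃ l : L1 →L[ℝ] ℝ, ∀ f : L1, 0 ≤ f → 0 ≤ l f ∧
      ENNReal.ofReal (l f) = ∫⁻ p, ENNReal.ofReal (W p) * ENNReal.ofReal (f p) := by
  have hi : ∀ f : L1, Integrable fun p => W p * f p := fun f => by
    refine ((L1.integrable_coeFn f).norm.const_mul R).mono'
      (hW.aestronglyMeasurable.mul (Lp.aestronglyMeasurable f)) (ae_of_all _ fun p => ?_)
    rw [norm_mul, Real.norm_of_nonneg (h0 p)]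
    exact mul_le_mul_of_nonneg_right (hR p) (norm_nonneg _)
  let l : L1 →ₗ[ℝ] ℝ :=
    { toFun := fun f => ∫ p, W p * f p
      map_add' := fun f g => by
        rw [← integral_add (hi f) (hi g)]
        refine integral_congr_ae ?_
        filter_upwards [Lp.coeFn_add f g] with p hp
        rw [hp, Pi.add_apply, mul_add]
      map_smul' := fun r f => by
        rw [RingHom.id_apply, smul_eq_mul, ← integral_const_mul]
        refine integral_congr_ae ?_
        filter_upwards [Lp.coeFn_smul r f] with p hp
        rw [hp, Pi.smul_apply, smul_eq_mul, mul_left_comm] }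
  refine ⟨l.mkContinuous R fun f => ?_, fun f hf => ?_⟩
  · rw [L1.norm_eq_integral_norm, ← integral_const_mul]
    refine norm_integral_le_of_norm_le ((L1.integrable_coeFn f).norm.const_mul R)
      (ae_of_all _ fun p => ?_)
    rw [norm_mul, Real.norm_of_nonneg (h0 p)]
    exact mul_le_mul_of_nonneg_right (hR p) (norm_nonneg _)
  · have hnn : 0 ≤ᵐ[volume] fun p => W p * f p := by
      filter_upwards [(Lp.coeFn_nonneg f).2 hf] with p hp
      exact mul_nonneg (h0 p) hp
    refine ⟨integral_nonneg_of_ae hnn, ?_⟩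
    refine (ofReal_integral_eq_lintegral_ofReal (hi f) hnn).trans ?_
    exact lintegral_congr fun p => ENNReal.ofReal_mul (h0 p)

/-- Dropping the loss leaves the Riccati inequality `y' ≤ D y²` for the truncated moment. The
barrier is linear and doubles from `X` to `2 X` over `[0, T]`. -/
theorem lintegral_cutWeight_solution_le {C₁ b ε R X T : ℝ} (hC : 0 < C₁) (hb : 0 < b) (hb2 : b < 2)
    (hε : 0 < ε) (hR : truncationLevel b ε ≤ R) {f₀ : L1} {f : ℝ → L1}
    (hf : IsModifiedSolution C₁ b ε f₀ f) (hpos : ∀ s, 0 ≤ s → 0 ≤ f s)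
    (hiso : ∀ s, 0 ≤ s → IsIsotropic (f s)) (hX : 0 < X)
    (hX₀ : ∫⁻ p, ENNReal.ofReal (momentWeight p) * ENNReal.ofReal (f₀ p) ≤ ENNReal.ofReal X)
    (hT : T = 1 / (8 * ((growthConst C₁ b).toReal + 1) * X)) {s : ℝ} (hs : s ∈ Icc 0 T) :
    ∫⁻ p, ENNReal.ofReal (cutWeight R p) * ENNReal.ofReal (f s p) ≤ ENNReal.ofReal (2 * X) := by
  have hR0 : 0 ≤ R := by
    refine le_trans ?_ hR
    unfold truncationLevel; positivity
  obtain ⟨l, hl⟩ := exists_clm_eq_integral_mul (measurable_cutWeight R)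
    (fun p => le_min (zero_le_one.trans (one_le_momentWeight p)) hR0) (fun p => min_le_right _ _)
  obtain ⟨hf0, hf'⟩ := (isModifiedSolution_iff hC hb hε).1 hf
  set D := (growthConst C₁ b).toReal with hD
  have hD0 : 0 ≤ D := ENNReal.toReal_nonneg
  have hT0 : 0 < T := by rw [hT]; positivity
  have hder : ∀ s, 0 ≤ s → l (collisionL1 hC hb hε (f s)) ≤ D * (l (f s)) ^ 2 := by
    intro s hs
    have hp := hpos s hs
    have h1 : l (collisionL1 hC hb hε (f s)) ≤ l ((isBilinearKernel_gain hC hb hε).clm (f s) (f s)) := by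
      rw [collisionL1, map_sub]
      have := (hl _ ((isBilinearKernel_loss hC hb hε).clm_nonneg hp hp)).1
      linarith
    refine h1.trans ?_
    have h2 := lintegral_cutWeight_gain_le hC hb hb2 hε hR hp (hiso s hs)
    obtain ⟨h3, h4⟩ := hl (f s) hp
    rw [← (hl _ ((isBilinearKernel_gain hC hb hε).clm_nonneg hp hp)).2, ← h4,
      ← ENNReal.ofReal_toReal (growthConst_lt_top C₁ hb2).ne, ← ENNReal.ofReal_pow h3,
      ← ENNReal.ofReal_mul hD0] at h2
    exact (ENNReal.ofReal_le_ofReal_iff (by positivity)).1 h2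
  have hlf : ∀ s, 0 ≤ s → HasDerivWithinAt (fun s => l (f s)) (l (collisionL1 hC hb hε (f s)))
      (Ici 0) s := fun s hs => l.hasFDerivAt.comp_hasDerivWithinAt s (hf' s hs)
  have hbar := image_le_of_deriv_right_lt_deriv_boundary (f := fun s => l (f s)) (a := 0) (b := T)
    (f' := fun s => l (collisionL1 hC hb hε (f s))) (B := fun s => X * (1 + s / T))
    (B' := fun _ => X / T)
    (fun s hs => (hlf s hs.1).continuousWithinAt.mono Icc_subset_Ici_self)
    (fun s hs => (hlf s hs.1).mono (Ici_subset_Ici.2 hs.1)) ?_ (fun s => ?_) (fun s hs heq => ?_) hs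
  · rw [← (hl (f s) (hpos s hs.1)).2]
    refine ENNReal.ofReal_le_ofReal (hbar.trans ?_)
    have : s / T ≤ 1 := (div_le_one hT0).2 hs.2
    nlinarith
  · simp only [zero_div, add_zero, mul_one]
    rw [← ENNReal.ofReal_le_ofReal_iff hX.le, (hl (f 0) (hpos 0 le_rfl)).2, hf0]
    refine le_trans (lintegral_mono fun p => ?_) hX₀
    gcongr
    exact min_le_left _ _
  · refine ((((hasDerivAt_id' s).div_const T).const_add 1).const_mul X).congr_deriv ?_
    rw [mul_one_div]
  · have hs1 : s / T ≤ 1 := (div_le_one hT0).2 hs.2.le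
    have hs0 : 0 ≤ s / T := div_nonneg hs.1 hT0.le
    have heq' : l (f s) = X * (1 + s / T) := heq
    have h5 : (X * (1 + s / T)) ^ 2 ≤ (X * 2) ^ 2 := by gcongr; linarith
    -- At contact with the barrier the moment is at most `2 X`, so its slope is at most `4 D X²`,
    -- strictly below this. The `+ 1` in `T` covers `D = 0`.
    have h6 : X / T = 8 * (D + 1) * X ^ 2 := by rw [hT]; field_simp
    calc l (collisionL1 hC hb hε (f s)) ≤ D * (l (f s)) ^ 2 := hder s hs.1
      _ ≤ D * (X * 2) ^ 2 := by rw [heq']; gcongr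
      _ < X / T := by rw [h6]; nlinarith [sq_pos_of_pos hX, mul_nonneg hD0 (sq_nonneg X)]

theorem lintegral_momentWeight_le_of_cutWeight {Y : ENNReal} {R₀ : ℝ} {f : Mom → ENNReal}
    (hf : Measurable f)
    (h : ∀ R, R₀ ≤ R → ∫⁻ p, ENNReal.ofReal (cutWeight R p) * f p ≤ Y) :
    ∫⁻ p, ENNReal.ofReal (momentWeight p) * f p ≤ Y := by
  have hlim : Filter.Tendsto (fun n : ℕ => ∫⁻ p, ENNReal.ofReal (cutWeight n p) * f p)
      Filter.atTop (nhds (∫⁻ p, ENNReal.ofReal (momentWeight p) * f p)) := by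
    refine lintegral_tendsto_of_tendsto_of_monotone
      (fun n => (by fun_prop : Measurable fun p => ENNReal.ofReal (cutWeight n p) * f p).aemeasurable)
      (ae_of_all _ fun p m n hmn => ?_) (ae_of_all _ fun p => ?_)
    · have : (m : ℝ) ≤ n := by exact_mod_cast hmn
      simp only [cutWeight]
      gcongr
    · refine tendsto_nhds_of_eventually_eq ?_
      filter_upwards [Filter.eventually_ge_atTop ⌈momentWeight p⌉₊] with n hn
      rw [cutWeight, min_eq_left (Nat.ceil_le.1 hn)]
  refine le_of_tendsto hlim ?_
  filter_upwards [Filter.eventually_ge_atTop ⌈R₀⌉₊] with n hn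
  exact h n (Nat.ceil_le.1 hn)

theorem moment_le_of_lintegral_momentWeight_le {f : L1} (hf : 0 ≤ f) {Y : ℝ} (hY : 0 ≤ Y)
    (h : ∫⁻ p, ENNReal.ofReal (momentWeight p) * ENNReal.ofReal (f p) ≤ ENNReal.ofReal Y) {m : ℝ}
    (h1 : -2 ≤ m) (h2 : m ≤ 2) :
    Integrable (momentIntegrand m f) ∧ ∫ p, momentIntegrand m f p ≤ Y := by
  have hfm := (Lp.stronglyMeasurable f).measurable
  have hm : Measurable (momentIntegrand m f) := by unfold momentIntegrand; fun_prop
  have hnn : 0 ≤ᵐ[volume] momentIntegrand m f := by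
    filter_upwards [(Lp.coeFn_nonneg f).2 hf] with p hp
    exact mul_nonneg hp (Real.rpow_nonneg (norm_nonneg _) _)
  have hle : ∫⁻ p, ENNReal.ofReal (momentIntegrand m f p) ≤ ENNReal.ofReal Y := by
    refine le_trans (lintegral_mono_ae ?_) h
    filter_upwards [(Lp.coeFn_nonneg f).2 hf] with p hp
    rw [momentIntegrand, mul_comm, ENNReal.ofReal_mul (Real.rpow_nonneg (norm_nonneg _) _)]
    gcongr
    exact norm_rpow_le_momentWeight p h1 h2
  refine ⟨⟨hm.aestronglyMeasurable, ?_⟩, ?_⟩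
  · rw [hasFiniteIntegral_iff_ofReal hnn]
    exact hle.trans_lt ENNReal.ofReal_lt_top
  · rw [integral_eq_lintegral_of_nonneg_ae hnn hm.aestronglyMeasurable]
    exact ENNReal.toReal_le_of_le_ofReal hY hle

theorem exists_lintegral_momentWeight_le {f : L1} (hf : 0 ≤ f)
    (h : ∀ m : ℝ, -2 ≤ m → m ≤ 2 → Integrable (momentIntegrand m f)) :
    ∃ X : ℝ, 0 < X ∧
      ∫⁻ p, ENNReal.ofReal (momentWeight p) * ENNReal.ofReal (f p) ≤ ENNReal.ofReal X := by
  -- The exponents `0`, `2` and `-2` make up the weight.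
  have hi := ((h 0 (by norm_num) (by norm_num)).add (h 2 (by norm_num) le_rfl)).add
    (h (-2) le_rfl (by norm_num))
  have hw : momentIntegrand 0 f + momentIntegrand 2 f + momentIntegrand (-2) f =
      fun p => momentWeight p * f p := by
    ext p
    simp only [Pi.add_apply, momentIntegrand, momentWeight, Real.rpow_zero, Real.rpow_two,
      Real.rpow_neg (norm_nonneg p)]
    ring
  rw [hw] at hi
  have hnn : 0 ≤ᵐ[volume] fun p => momentWeight p * f p := by
    filter_upwards [(Lp.coeFn_nonneg f).2 hf] with p hp
    exact mul_nonneg (zero_le_one.trans (one_le_momentWeight p)) hp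
  refine ⟨(∫ p, momentWeight p * f p) + 1, by linarith [integral_nonneg_of_ae hnn], ?_⟩
  calc _ = ∫⁻ p, ENNReal.ofReal (momentWeight p * f p) := lintegral_congr fun p =>
        (ENNReal.ofReal_mul (zero_le_one.trans (one_le_momentWeight p))).symm
    _ = ENNReal.ofReal (∫ p, momentWeight p * f p) :=
        (ofReal_integral_eq_lintegral_ofReal hi hnn).symm
    _ ≤ _ := ENNReal.ofReal_le_ofReal (by linarith)

end MomentPropagation

end

end MasslessBoltzmann

theorem proposition1 (C₁ b : ℝ) (hC₁ : 0 < C₁) (hb₁ : 1 < b) (hb₂ : b < 2)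
    (f₀ : MasslessBoltzmann.L1) (hf₀ : 0 ≤ f₀) :
    (∀ ε : ℝ, 0 < ε → ∃ f : ℝ → MasslessBoltzmann.L1,
      MasslessBoltzmann.IsModifiedSolution C₁ b ε f₀ f ∧
      (∀ s : ℝ, 0 ≤ s → 0 ≤ f s) ∧
      (MasslessBoltzmann.IsIsotropic f₀ →
        ∀ s : ℝ, 0 ≤ s → MasslessBoltzmann.IsIsotropic (f s)) ∧
      (∀ g : ℝ → MasslessBoltzmann.L1,
        MasslessBoltzmann.IsModifiedSolution C₁ b ε f₀ g → EqOn g f (Ici 0))) ∧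
    (MasslessBoltzmann.IsIsotropic f₀ →
      (∀ m : ℝ, -2 ≤ m → m ≤ 2 →
        Integrable (MasslessBoltzmann.momentIntegrand m f₀) volume) →
      ∃ T : ℝ, 0 < T ∧ ∃ C : ℝ, ∀ ε : ℝ, 0 < ε → ∀ f : ℝ → MasslessBoltzmann.L1,
        MasslessBoltzmann.IsModifiedSolution C₁ b ε f₀ f →
        ∀ s : ℝ, 0 ≤ s → s ≤ T → ∀ m : ℝ, -2 ≤ m → m ≤ 2 →
          Integrable (MasslessBoltzmann.momentIntegrand m (f s)) volume ∧
          ∫ p, MasslessBoltzmann.momentIntegrand m (f s) p ≤ C) := by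
  have hb : 0 < b := zero_lt_one.trans hb₁
  refine ⟨fun ε hε => ?_, fun hiso hmom => ?_⟩
  · obtain ⟨f, hf, hpos, hiso⟩ :=
      MasslessBoltzmann.exists_isModifiedSolution hC₁ hb hε hf₀
    exact ⟨f, hf, hpos, hiso, fun g hg => hg.eqOn hC₁ hb hε hf⟩
  · obtain ⟨X, hX, hX₀⟩ := MasslessBoltzmann.exists_lintegral_momentWeight_le hf₀ hmom
    refine ⟨1 / (8 * ((MasslessBoltzmann.growthConst C₁ b).toReal + 1) * X), by positivity, 2 * X,
      fun ε hε f hf s hs0 hsT m h1 h2 => ?_⟩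
    -- Sign and isotropy are known for the constructed solution; uniqueness transfers them to `f`.
    obtain ⟨g, hg, hgpos, hgiso⟩ :=
      MasslessBoltzmann.exists_isModifiedSolution hC₁ hb hε hf₀
    rw [hf.eqOn hC₁ hb hε hg hs0]
    refine MasslessBoltzmann.moment_le_of_lintegral_momentWeight_le (hgpos s hs0) (by positivity)
      ?_ h1 h2
    -- The truncation threshold depends on `ε`, but it disappears in the limit, so `T` and `2 * X`
    -- do not.
    refine MasslessBoltzmann.lintegral_momentWeight_le_of_cutWeight
      (R₀ := MasslessBoltzmann.truncationLevel b ε)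
      (Lp.stronglyMeasurable (g s)).measurable.ennreal_ofReal fun R hR => ?_
    exact MasslessBoltzmann.lintegral_cutWeight_solution_le hC₁ hb hb₂ hε hR hg hgpos (hgiso hiso)
      hX hX₀ rfl ⟨hs0, hsT⟩
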